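/- Let $\mathcal F$ be a finite simplicial complex, let $q\ge 1$ be an integer, and let $[q]$ denote the $0$-dimensional simplicial complex consisting of $q$ distinct vertices. Let the $q$-cone of $\mathcal F$ be the join $\mathcal F*[q]=\{\sigma\cup\tau : \sigma\in\mathcal F\cup\{\emptyset\},\ \tau\in[q]\cup\{\emptyset\}\}$, formed on the disjoint union of the two vertex sets, and let $|\cdot|$ denote geometric realization. Let $M$ be a coefficient module over a ring $R$ (for example $R=M=\mathbb Z$, or $R=M$ a field), and let $\tilde H_n(X)$, $n\in\mathbb Z$, denote the $n$-th reduced singular homology of a space $X$ with coefficients in $M$, that is, the homology of the augmented singular chain complex $\cdots\to C_1(X;M)\to C_0(X;M)\to M\to 0$ with $M$ in degree $-1$. Then for every $n\in\mathbb Z$ there is an isomorphism of $R$-modules $$\tilde H_n(|\mathcal F*[q]|)\;\cong\;\bigoplus_{(q-1)\text{ times}}\tilde H_{n-1}(|\mathcal F|).$$ -/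

import Mathlib

open CategoryTheory

universe u v

section Complexes

/-- The join `F * K` of two abstract simplicial complexes, on the disjoint union of the two vertex
types: its faces are the unions `σ ∪ τ` with `σ ∈ F ∪ {∅}` and `τ ∈ K ∪ {∅}`. As everywhere in
Mathlib, only nonempty sets are recorded as faces, so `∅ ∪ ∅` is left out. -/
def simplicialJoin {V : Type*} {W : Type*} (F : PreAbstractSimplicialComplex V)
    (K : PreAbstractSimplicialComplex W) : PreAbstractSimplicialComplex (V ⊕ W) where
  faces := {s | s.Nonempty ∧ ∃ (σ : Finset V) (τ : Finset W),
    (σ ∈ F.faces ∨ σ = ∅) ∧ (τ ∈ K.faces ∨ τ = ∅) ∧ s = σ.disjSum τ}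
  isRelLowerSet_faces := by
    rintro s ⟨hs, σ, τ, hσ, hτ, rfl⟩
    refine ⟨hs, fun t ht htne => ⟨htne, t.toLeft, t.toRight, ?_, ?_, ?_⟩⟩
    · have hsub : t.toLeft ⊆ σ := fun a ha => by
        simpa using ht (Finset.mem_toLeft.mp ha)
      rcases t.toLeft.eq_empty_or_nonempty with h | h
      · exact Or.inr h
      · rcases hσ with hσ | rfl
        · exact Or.inl ((F.isRelLowerSet_faces hσ).2 hsub h)
        · exact Or.inr (Finset.subset_empty.mp hsub)
    · have hsub : t.toRight ⊆ τ := fun a ha => by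
        simpa using ht (Finset.mem_toRight.mp ha)
      rcases t.toRight.eq_empty_or_nonempty with h | h
      · exact Or.inr h
      · rcases hτ with hτ | rfl
        · exact Or.inl ((K.isRelLowerSet_faces hτ).2 hsub h)
        · exact Or.inr (Finset.subset_empty.mp hsub)
    · exact Finset.toLeft_disjSum_toRight.symm

/-- The `0`-dimensional simplicial complex `[q]`: `q` distinct vertices and no other faces. -/
def discreteComplex (q : ℕ) : PreAbstractSimplicialComplex (Fin q) where
  faces := {s | ∃ i, s = {i}}
  isRelLowerSet_faces := by
    rintro s ⟨i, rfl⟩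
    refine ⟨Finset.singleton_nonempty i, fun t ht htne => ⟨i, ?_⟩⟩
    exact (Finset.subset_singleton_iff.mp ht).resolve_left htne.ne_empty

/-- The `q`-cone `F * [q]`. -/
def qCone {V : Type*} (F : PreAbstractSimplicialComplex V) (q : ℕ) :
    PreAbstractSimplicialComplex (V ⊕ Fin q) :=
  simplicialJoin F (discreteComplex q)

/-- The geometric realization `|F|` in barycentric coordinates, as a set of functions `V → ℝ`:
the union over the faces `s` of `F` of the simplices spanned by the standard basis vectors
`e_v`, `v ∈ s`. -/
def realizationSet {V : Type*} (F : PreAbstractSimplicialComplex V) : Set (V → ℝ) :=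
  {x | (∀ w, 0 ≤ x w) ∧ ∃ s ∈ F.faces, (∀ w, w ∉ s → x w = 0) ∧ ∑ w ∈ s, x w = 1}

/-- The geometric realization `|F|` of a finite simplicial complex as a topological space, with the
topology induced by the product topology on `V → ℝ`. For complexes with finitely many faces,
the only ones for which it is used, this is the usual topology of a Euclidean polyhedron. -/
def geometricRealization {V : Type u} (F : PreAbstractSimplicialComplex V) : TopCat.{u} :=
  TopCat.of (realizationSet F)

end Complexes

noncomputable section ReducedHomology

variable {R : Type v} [Ring R]

/-- The singular chain complex of `X` with coefficients in `M`. -/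
abbrev singularChains (M : ModuleCat.{u} R) (X : TopCat.{u}) : ChainComplex (ModuleCat.{u} R) ℕ :=
  (TopCat.toSSet.obj X).chainComplex M

/-- The augmentation `C₀(X; M) ⟶ M`, which is the identity of `M` on the summand of every
singular `0`-simplex (that is, it sends `∑ mᵢ xᵢ` to `∑ mᵢ`). -/
def singularAugmentation (M : ModuleCat.{u} R) (X : TopCat.{u}) :
    (singularChains M X).X 0 ⟶ M :=
  ((TopCat.toSSet.obj X).isColimitChainComplexXCofan M 0).desc
    (Limits.Cofan.mk M fun _ => 𝟙 M)

theorem ι_singularAugmentation (M : ModuleCat.{u} R) (X : TopCat.{u})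
    (x : (TopCat.toSSet.obj X).obj (Opposite.op (SimplexCategory.mk 0))) :
    (TopCat.toSSet.obj X).ιChainComplex x ≫ singularAugmentation M X = 𝟙 M :=
  ((TopCat.toSSet.obj X).isColimitChainComplexXCofan M 0).fac
    (Limits.Cofan.mk M fun _ => 𝟙 M) ⟨x⟩

theorem d_singularAugmentation (M : ModuleCat.{u} R) (X : TopCat.{u}) :
    (singularChains M X).d 1 0 ≫ singularAugmentation M X = 0 := by
  apply SSet.chainComplex_hom_ext
  intro x
  rw [SSet.ιChainComplex_d_assoc]
  simp [Fin.sum_univ_two, Preadditive.add_comp, Preadditive.neg_comp, ι_singularAugmentation]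

/-- The augmented singular chain complex `⋯ ⟶ C₁(X; M) ⟶ C₀(X; M) ⟶ M ⟶ 0`. It is indexed
by `ℕ`, with `M` at index `0` and `Cₙ(X; M)` at index `n + 1`. -/
def augmentedSingularChains (M : ModuleCat.{u} R) (X : TopCat.{u}) :
    ChainComplex (ModuleCat.{u} R) ℕ :=
  (singularChains M X).augment (singularAugmentation M X) (d_singularAugmentation M X)

/-- The reduced singular homology `H̃ₙ(X; M)`, `n ∈ ℤ`: the homology of the augmented singular
chain complex, where `Cₙ(X; M)` has degree `n`, `M` has degree `-1`, and all modules in degrees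
below `-1` are zero. -/
def reducedHomology (M : ModuleCat.{u} R) (X : TopCat.{u}) : ℤ → ModuleCat.{u} R
  | Int.ofNat n => (augmentedSingularChains M X).homology (n + 1)
  | Int.negSucc 0 => (augmentedSingularChains M X).homology 0
  | Int.negSucc (_ + 1) => ModuleCat.of R PUnit.{u + 1}

end ReducedHomology

/-!
Write `H̃` for reduced homology and `Cₖ` for the `k`-cone `F * [k]`, realized as the part of
`|F * [q]|` on which the coordinates at all but the first `k` apexes vanish (`partialCone`). The
theorem follows by induction on `k ≥ 1` from

* `C₁` is contractible, by the straight line homotopy to its apex, and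
* `H̃ₙ₊₁(Cₖ₊₁) ≅ H̃ₙ₊₁(Cₖ) × H̃ₙ(|F|)` for `k ≥ 1`.

For the second point, cover `Cₖ₊₁` by the complement `U` of the last apex and the open star `V` of
that apex. Then `V` is contractible (`openStar_homotopic`), `U` deformation retracts onto `Cₖ`
(`coneRetr`), and `U ∩ V` is homotopy equivalent to `|F|` (`baseIncl`, `baseProj`). Folding the last
cone onto the first one (`coneFold`) is a retraction of `Cₖ₊₁` onto `Cₖ`, so that `H̃(U) → H̃(Cₖ₊₁)`
is a split monomorphism, and the reduced Mayer–Vietoris sequence breaks up into split short exact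
sequences `0 → H̃ₙ₊₁(U) → H̃ₙ₊₁(Cₖ₊₁) → H̃ₙ(U ∩ V) → 0` (`nonempty_homology_equiv_of_cover`).

The Mayer–Vietoris sequence and the homotopy invariance of singular homology are proved along the
way. Both are obtained from chain operators on affine chains of standard simplices, defined by
recursion with cones as acyclic models and transported to singular chains by naturality: barycentric
subdivision `AffineChain.subdiv`, and one operator `AffineChain.prism` that is a chain homotopy
between the bottom of a prism and the subdivided top. For a homotopy from `f` to `g` it shows that
`f` and `g ∘ subdivision` induce the same map on homology; for the constant homotopy it shows that
subdivision is homologous to the identity, which with the Lebesgue number lemma gives that chains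
subordinate to an open cover compute the homology.

Augmented complexes are treated uniformly by admitting the empty simplex: `concreteChains M X` has,
in degree `n`, the chains on maps from the simplex with `n` vertices, and for `n = 0` the single map
from the empty simplex accounts for the coefficient module. Thus its homology in degree `n + 1` is
`H̃ₙ` (`augmentedSingularChainsIso`), and everything holds down to degree `-1`, with `F` possibly
empty.
-/


set_option autoImplicit false

/-! ### Affine chains of standard simplices -/

noncomputable section AffineSimplices

variable {ι κ μ : Type*} [Fintype ι] [Fintype κ] [Fintype μ]

/-- The convex combination `∑ i, t i • w i` of points `w i` of the standard simplex on `κ`. A family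
`w : ι → stdSimplex ℝ κ` thus encodes an affine map between standard simplices. -/
def convexComb (w : ι → stdSimplex ℝ κ) (t : stdSimplex ℝ ι) : stdSimplex ℝ κ :=
  ⟨∑ i, t i • (w i : κ → ℝ), (convex_stdSimplex ℝ κ).sum_mem (fun i _ => t.2.1 i) t.2.2
    fun i _ => (w i).2⟩

theorem convexComb_apply (w : ι → stdSimplex ℝ κ) (t : stdSimplex ℝ ι) (a : κ) :
    convexComb w t a = ∑ i, t i * w i a := by
  change (∑ i, t i • (w i : κ → ℝ)) a = _
  simp only [Finset.sum_apply, Pi.smul_apply, smul_eq_mul]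

theorem convexComb_convexComb (w : κ → stdSimplex ℝ μ) (v : ι → stdSimplex ℝ κ)
    (t : stdSimplex ℝ ι) :
    convexComb w (convexComb v t) = convexComb (fun i => convexComb w (v i)) t := by
  ext a
  simp only [convexComb_apply, Finset.sum_mul, Finset.mul_sum]
  rw [Finset.sum_comm]
  simp only [mul_assoc]

theorem convexComb_vertex [DecidableEq ι] (w : ι → stdSimplex ℝ κ) (i : ι) :
    convexComb w (stdSimplex.vertex i) = w i := by
  ext a
  simp [convexComb_apply, Pi.single_apply]

theorem convexComb_vertex_left [DecidableEq ι] (t : stdSimplex ℝ ι) :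
    convexComb stdSimplex.vertex t = t := by
  ext a
  simp [convexComb_apply, Pi.single_apply]

theorem continuous_convexComb (w : ι → stdSimplex ℝ κ) : Continuous (convexComb w) :=
  Continuous.subtype_mk (continuous_finsetSum _ fun i _ =>
    ((continuous_apply i).comp continuous_subtype_val).smul continuous_const) _

/-- The affine map between standard simplices with prescribed images of the vertices. -/
def affineSimplex (w : ι → stdSimplex ℝ κ) : C(stdSimplex ℝ ι, stdSimplex ℝ κ) :=
  ⟨convexComb w, continuous_convexComb w⟩

@[simp]
theorem affineSimplex_apply (w : ι → stdSimplex ℝ κ) (t : stdSimplex ℝ ι) :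
    affineSimplex w t = convexComb w t := rfl

/-- The vertices of the `i`-th face of the standard simplex. -/
def faceVertices {k : ℕ} (i : Fin (k + 1)) : Fin k → stdSimplex ℝ (Fin (k + 1)) :=
  fun j => stdSimplex.vertex (i.succAbove j)

/-- The barycenter of an affine simplex. -/
def bary {k : ℕ} (w : Fin (k + 1) → stdSimplex ℝ κ) : stdSimplex ℝ κ :=
  convexComb w stdSimplex.barycenter

/-- Affine chains: formal integral combinations of affine simplices with `k` vertices in the
standard simplex on `κ`. The case `k = 0` is the degree of the augmentation. -/
abbrev AffineChain (k : ℕ) (κ : Type*) [Fintype κ] := (Fin k → stdSimplex ℝ κ) →₀ ℤ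

namespace AffineChain

/-- The additive extension of a map defined on affine simplices. -/
def lift {A B : Type*} [AddCommGroup B] (f : A → B) : (A →₀ ℤ) →+ B :=
  Finsupp.liftAddHom fun a => (zmultiplesHom B) (f a)

@[simp]
theorem lift_single {A B : Type*} [AddCommGroup B] (f : A → B) (a : A) (n : ℤ) :
    lift f (Finsupp.single a n) = n • f a := by
  simp [lift]

theorem hom_ext {A B : Type*} [AddCommGroup B] {f g : (A →₀ ℤ) →+ B}
    (h : ∀ a, f (Finsupp.single a 1) = g (Finsupp.single a 1)) : f = g := by
  ext a
  simpa using h a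

/-- The boundary of an affine chain. -/
def bd (k : ℕ) : AffineChain (k + 1) κ →+ AffineChain k κ :=
  lift fun w => ∑ i : Fin (k + 1), (-1 : ℤ) ^ (i : ℕ) • Finsupp.single (w ∘ i.succAbove) 1

theorem bd_single {k : ℕ} (w : Fin (k + 1) → stdSimplex ℝ κ) :
    bd k (Finsupp.single w 1) =
      ∑ i : Fin (k + 1), (-1 : ℤ) ^ (i : ℕ) • Finsupp.single (w ∘ i.succAbove) 1 := by
  simp [bd]

/-- The cone on an affine chain with apex `b`, the new first vertex. -/
def cone (k : ℕ) (b : stdSimplex ℝ κ) : AffineChain k κ →+ AffineChain (k + 1) κ :=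
  lift fun w => Finsupp.single (Fin.cons b w : Fin (k + 1) → stdSimplex ℝ κ) 1

theorem cone_single {k : ℕ} (b : stdSimplex ℝ κ) (w : Fin k → stdSimplex ℝ κ) :
    cone k b (Finsupp.single w 1) = Finsupp.single (Fin.cons b w) 1 := by
  simp [cone]

/-- The image of an affine chain under an affine map. -/
def push (k : ℕ) (v : ι → stdSimplex ℝ κ) : AffineChain k ι →+ AffineChain k κ :=
  lift fun w => Finsupp.single (fun j => convexComb v (w j)) 1

theorem push_single {k : ℕ} (v : ι → stdSimplex ℝ κ) (w : Fin k → stdSimplex ℝ ι) :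
    push k v (Finsupp.single w 1) = Finsupp.single (fun j => convexComb v (w j)) 1 := by
  simp [push]

theorem push_push {k : ℕ} (w : κ → stdSimplex ℝ μ) (v : ι → stdSimplex ℝ κ)
    (c : AffineChain k ι) :
    push k w (push k v c) = push k (fun i => convexComb w (v i)) c := by
  suffices h : (push k w).comp (push k v) = push k (fun i => convexComb w (v i)) from
    DFunLike.congr_fun h c
  refine hom_ext fun a => ?_
  simp [push_single, convexComb_convexComb]

theorem bd_cone_succ {k : ℕ} (b : stdSimplex ℝ κ) (c : AffineChain (k + 1) κ) :
    bd (k + 1) (cone (k + 1) b c) = c - cone k b (bd k c) := by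
  suffices h : (bd (k + 1)).comp (cone (k + 1) b) =
      AddMonoidHom.id _ - (cone k b).comp (bd k) from DFunLike.congr_fun h c
  refine hom_ext fun w => ?_
  simp only [AddMonoidHom.comp_apply, cone_single, bd_single, AddMonoidHom.sub_apply,
    AddMonoidHom.id_apply]
  rw [Fin.sum_univ_succ, map_sum, sub_eq_add_neg, ← Finset.sum_neg_distrib]
  congr 1
  · simp [Function.comp_def]
  · refine Finset.sum_congr rfl fun i _ => ?_
    rw [map_zsmul, cone_single, Fin.val_succ, pow_succ, mul_neg_one, neg_smul]
    congr 3
    ext j : 1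
    refine Fin.cases ?_ (fun j => ?_) j <;> simp

theorem bd_cone_zero (b : stdSimplex ℝ κ) (c : AffineChain 0 κ) :
    bd 0 (cone 0 b c) = c := by
  suffices h : (bd 0).comp (cone 0 b) = AddMonoidHom.id _ from DFunLike.congr_fun h c
  refine hom_ext fun w => ?_
  simp only [AddMonoidHom.comp_apply, cone_single, bd_single, AddMonoidHom.id_apply]
  simp [Subsingleton.elim _ w]

theorem bd_push {k : ℕ} (v : ι → stdSimplex ℝ κ) (c : AffineChain (k + 1) ι) :
    bd k (push (k + 1) v c) = push k v (bd k c) := by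
  suffices h : (bd k).comp (push (k + 1) v) = (push k v).comp (bd k) from DFunLike.congr_fun h c
  refine hom_ext fun w => ?_
  simp only [AddMonoidHom.comp_apply, push_single, bd_single, map_sum, map_zsmul]
  rfl

theorem push_cone {k : ℕ} (v : ι → stdSimplex ℝ κ) (b : stdSimplex ℝ ι) (c : AffineChain k ι) :
    push (k + 1) v (cone k b c) = cone k (convexComb v b) (push k v c) := by
  suffices h : (push (k + 1) v).comp (cone k b) = (cone k (convexComb v b)).comp (push k v) from
    DFunLike.congr_fun h c
  refine hom_ext fun w => ?_
  simp only [AddMonoidHom.comp_apply, push_single, cone_single]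
  congr 1
  ext j : 1
  refine Fin.cases ?_ (fun j => ?_) j <;> simp

/-- Each simplex with a vertex is the cone on its opposite face, so that this follows by induction
from the formula for the boundary of a cone. -/
theorem bd_bd {k : ℕ} (c : AffineChain (k + 2) κ) : bd k (bd (k + 1) c) = 0 := by
  induction k with
  | zero =>
    suffices h : (bd 0).comp (bd (1)) = (0 : AffineChain 2 κ →+ _) from DFunLike.congr_fun h c
    refine hom_ext fun w => ?_
    obtain ⟨b, w, rfl⟩ : ∃ b w', w = Fin.cons b w' := ⟨_, _, (Fin.cons_self_tail w).symm⟩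
    rw [AddMonoidHom.comp_apply, ← cone_single, bd_cone_succ, map_sub, bd_cone_zero, sub_self]
    rfl
  | succ k ih =>
    suffices h : (bd (k + 1)).comp (bd (k + 2)) = (0 : AffineChain (k + 3) κ →+ _) from
      DFunLike.congr_fun h c
    refine hom_ext fun w => ?_
    obtain ⟨b, w, rfl⟩ : ∃ b w', w = Fin.cons b w' := ⟨_, _, (Fin.cons_self_tail w).symm⟩
    rw [AddMonoidHom.comp_apply, ← cone_single, bd_cone_succ, map_sub, bd_cone_succ, ih, map_zero,
      sub_zero, sub_self]
    rfl

/-- Barycentric subdivision of affine chains: the subdivision of a simplex is the cone, with apex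
its barycenter, on the subdivision of its boundary. -/
def subdiv : ∀ k : ℕ, AffineChain k κ →+ AffineChain k κ
  | 0 => AddMonoidHom.id _
  | k + 1 => lift fun w => cone k (bary w) (subdiv k (bd k (Finsupp.single w 1)))

theorem subdiv_single {k : ℕ} (w : Fin (k + 1) → stdSimplex ℝ κ) :
    subdiv (k + 1) (Finsupp.single w 1) =
      cone k (bary w) (subdiv k (bd k (Finsupp.single w 1))) := by
  simp [subdiv]

theorem bary_push {k : ℕ} (v : ι → stdSimplex ℝ κ) (w : Fin (k + 1) → stdSimplex ℝ ι) :
    bary (fun j => convexComb v (w j)) = convexComb v (bary w) :=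
  (convexComb_convexComb _ _ _).symm

theorem subdiv_push {k : ℕ} (v : ι → stdSimplex ℝ κ) (c : AffineChain k ι) :
    subdiv k (push k v c) = push k v (subdiv k c) := by
  induction k with
  | zero => rfl
  | succ k ih =>
    suffices h : (subdiv (k + 1)).comp (push (k + 1) v) = (push (k + 1) v).comp (subdiv (k + 1))
      from DFunLike.congr_fun h c
    refine hom_ext fun w => ?_
    rw [AddMonoidHom.comp_apply, AddMonoidHom.comp_apply, subdiv_single, push_cone, ← ih,
      ← bd_push, push_single, subdiv_single, bary_push]

theorem bd_subdiv {k : ℕ} (c : AffineChain (k + 1) κ) :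
    bd k (subdiv (k + 1) c) = subdiv k (bd k c) := by
  induction k with
  | zero =>
    suffices h : (bd 0).comp (subdiv 1) = (subdiv 0).comp (bd (κ := κ) 0) from
      DFunLike.congr_fun h c
    refine hom_ext fun w => ?_
    rw [AddMonoidHom.comp_apply, AddMonoidHom.comp_apply, subdiv_single, bd_cone_zero]
  | succ k ih =>
    suffices h : (bd (k + 1)).comp (subdiv (k + 2)) = (subdiv (k + 1)).comp (bd (κ := κ) (k + 1))
      from DFunLike.congr_fun h c
    refine hom_ext fun w => ?_
    rw [AddMonoidHom.comp_apply, AddMonoidHom.comp_apply, subdiv_single, bd_cone_succ, ih, bd_bd,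
      map_zero, map_zero, sub_zero]

/-! ### The prism operator and the chain homotopy formula -/

section Prism

variable [DecidableEq ι] [DecidableEq κ]

/-- The bottom (`e = 0`) and the top (`e = 1`) of the prism on the standard simplex on `κ`. The
prism is modelled by the standard simplex on `κ × Fin 2`. -/
def prismEnd (κ : Type*) [Fintype κ] [DecidableEq κ] (e : Fin 2) : κ → stdSimplex ℝ (κ × Fin 2) :=
  fun a => stdSimplex.vertex (a, e)

/-- The affine map of prisms induced by an affine map of simplices. -/
def prismMap (v : ι → stdSimplex ℝ κ) : ι × Fin 2 → stdSimplex ℝ (κ × Fin 2) :=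
  fun p => convexComb (prismEnd κ p.2) (v p.1)

theorem convexComb_prismMap_prismEnd (v : ι → stdSimplex ℝ κ) (e : Fin 2) (t : stdSimplex ℝ ι) :
    convexComb (prismMap v) (convexComb (prismEnd ι e) t) =
      convexComb (prismEnd κ e) (convexComb v t) := by
  rw [convexComb_convexComb, convexComb_convexComb]
  congr 1
  ext i : 1
  exact convexComb_vertex _ _

theorem push_prismMap_prismEnd {k : ℕ} (v : ι → stdSimplex ℝ κ) (e : Fin 2)
    (c : AffineChain k ι) :
    push k (prismMap v) (push k (prismEnd ι e) c) = push k (prismEnd κ e) (push k v c) := by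
  rw [push_push, push_push]
  congr 1
  congr 1
  ext i : 1
  exact convexComb_vertex _ _

/-- The prism operator, a natural chain homotopy from the inclusion of the bottom of the prism to
the subdivision of its top. -/
def prism : ∀ k : ℕ, AffineChain k κ →+ AffineChain (k + 1) (κ × Fin 2)
  | 0 => 0
  | k + 1 => lift fun w => cone (k + 1) (convexComb (prismEnd κ 0) (bary w))
      (push (k + 1) (prismEnd κ 1) (subdiv (k + 1) (Finsupp.single w 1)) -
        push (k + 1) (prismEnd κ 0) (Finsupp.single w 1) - prism k (bd k (Finsupp.single w 1)))

theorem prism_single {k : ℕ} (w : Fin (k + 1) → stdSimplex ℝ κ) :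
    prism (k + 1) (Finsupp.single w 1) = cone (k + 1) (convexComb (prismEnd κ 0) (bary w))
      (push (k + 1) (prismEnd κ 1) (subdiv (k + 1) (Finsupp.single w 1)) -
        push (k + 1) (prismEnd κ 0) (Finsupp.single w 1) -
          prism k (bd k (Finsupp.single w 1))) := by
  simp [prism]

theorem prism_push {k : ℕ} (v : ι → stdSimplex ℝ κ) (c : AffineChain k ι) :
    prism k (push k v c) = push (k + 1) (prismMap v) (prism k c) := by
  induction k with
  | zero => simp [prism]
  | succ k ih =>
    suffices h : (prism (k + 1)).comp (push (k + 1) v) =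
        (push (k + 2) (prismMap v)).comp (prism (k + 1)) from DFunLike.congr_fun h c
    refine hom_ext fun w => ?_
    rw [AddMonoidHom.comp_apply, AddMonoidHom.comp_apply, prism_single, push_cone,
      map_sub (push _ _), map_sub (push _ _), ← ih, push_prismMap_prismEnd,
      push_prismMap_prismEnd, ← subdiv_push, ← bd_push, push_single, prism_single,
      convexComb_prismMap_prismEnd, bary_push]

theorem bd_prism_zero (c : AffineChain 0 κ) :
    bd 0 (prism 0 c) = push 0 (prismEnd κ 1) (subdiv 0 c) - push 0 (prismEnd κ 0) c := by
  have h : push 0 (prismEnd κ 1) = push 0 (prismEnd κ 0) := by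
    refine hom_ext fun w => ?_
    rw [push_single, push_single]
    congr 1
    exact Subsingleton.elim _ _
  simp [prism, subdiv, h]

theorem bd_prism_succ {k : ℕ} (c : AffineChain (k + 1) κ) :
    bd (k + 1) (prism (k + 1) c) = push (k + 1) (prismEnd κ 1) (subdiv (k + 1) c) -
      push (k + 1) (prismEnd κ 0) c - prism k (bd k c) := by
  induction k with
  | zero =>
    suffices h : (bd 1).comp (prism 1) = (push 1 (prismEnd κ 1)).comp (subdiv 1) -
        push 1 (prismEnd κ 0) - (prism 0).comp (bd 0) from DFunLike.congr_fun h c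
    refine hom_ext fun w => ?_
    simp only [AddMonoidHom.comp_apply, AddMonoidHom.sub_apply]
    rw [prism_single, bd_cone_succ, sub_eq_self, map_sub (bd _), map_sub (bd _), bd_prism_zero,
      bd_push, bd_push, bd_subdiv, sub_self, map_zero]
  | succ k ih =>
    suffices h : (bd (k + 2)).comp (prism (k + 2)) =
        (push (k + 2) (prismEnd κ 1)).comp (subdiv (k + 2)) -
        push (k + 2) (prismEnd κ 0) - (prism (k + 1)).comp (bd (k + 1)) from
      DFunLike.congr_fun h c
    refine hom_ext fun w => ?_
    simp only [AddMonoidHom.comp_apply, AddMonoidHom.sub_apply]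
    -- The chain to which the cone is applied is a cycle, by the formula in one degree less.
    rw [prism_single, bd_cone_succ, sub_eq_self, map_sub (bd _), map_sub (bd _), ih, bd_push,
      bd_push, bd_bd, bd_subdiv, map_zero, sub_zero, sub_self, map_zero]

end Prism

/-! ### The mesh of iterated subdivisions -/

theorem lift_mem {A B : Type*} [AddCommGroup B] {f : A → B} {s : Set A} {S : Submodule ℤ B}
    (hf : ∀ a ∈ s, f a ∈ S) {c : A →₀ ℤ} (hc : c ∈ Finsupp.supported ℤ ℤ s) : lift f c ∈ S := by
  simp only [lift, Finsupp.liftAddHom_apply, Finsupp.sum]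
  exact S.sum_mem fun a ha => S.smul_mem _ (hf a (hc ha))

theorem dist_convexComb_le {w : ι → stdSimplex ℝ κ} {x : stdSimplex ℝ κ} {D : ℝ}
    (h : ∀ i, dist (w i) x ≤ D) (t : stdSimplex ℝ ι) : dist (convexComb w t) x ≤ D :=
  (convex_closedBall (x : κ → ℝ) D).sum_mem (fun i _ => t.2.1 i) t.2.2 fun i _ => h i

/-- The barycenter differs from a vertex by the average of the differences of all `k + 1` vertices
from it, one of which is zero. -/
theorem dist_bary_le {k : ℕ} {w : Fin (k + 1) → stdSimplex ℝ κ} {D : ℝ}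
    (h : ∀ i j, dist (w i) (w j) ≤ D) (j : Fin (k + 1)) :
    dist (bary w) (w j) ≤ k / (k + 1) * D := by
  have hD : 0 ≤ D := dist_nonneg.trans (h 0 0)
  rw [Subtype.dist_eq, dist_pi_le_iff (by positivity)]
  intro a
  have hb : (bary w).1 a = (k + 1 : ℝ)⁻¹ * ∑ i, (w i).1 a := by
    rw [Finset.mul_sum]
    refine (convexComb_apply _ _ a).trans (Finset.sum_congr rfl fun i _ => ?_)
    have : (stdSimplex.barycenter : stdSimplex ℝ (Fin (k + 1))) i = (k + 1 : ℝ)⁻¹ := by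
      refine (stdSimplex.barycenter_apply i).trans ?_
      simp
    rw [this]
    rfl
  have hs : (bary w).1 a - (w j).1 a =
      (k + 1 : ℝ)⁻¹ * ∑ i ∈ Finset.univ.erase j, ((w i).1 a - (w j).1 a) := by
    rw [Finset.sum_erase _ (sub_self _), Finset.sum_sub_distrib, hb]
    simp
    field_simp
  rw [Real.dist_eq, hs, abs_mul, abs_of_nonneg (by positivity), div_eq_inv_mul, mul_assoc]
  refine mul_le_mul_of_nonneg_left ((Finset.abs_sum_le_sum_abs _ _).trans ?_) (by positivity)
  refine (Finset.sum_le_card_nsmul _ _ D fun i _ => ?_).trans ?_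
  · exact (dist_le_pi_dist (w i).1 (w j).1 a).trans (h i j)
  · simp

/-- The affine simplices with vertices at mutual distance at most `D`. -/
def small (k : ℕ) (κ : Type*) [Fintype κ] (D : ℝ) : Set (Fin k → stdSimplex ℝ κ) :=
  {w | ∀ i j, dist (w i) (w j) ≤ D}

/-- The factor by which the subdivision shrinks simplices with `k` vertices, that is, `d / (d + 1)`
for the dimension `d = k - 1`. The truncated subtraction makes it `0` for the empty simplex. -/
def shrink (k : ℕ) : ℝ := (k - 1 : ℕ) / ((k - 1 : ℕ) + 1)

theorem shrink_nonneg (k : ℕ) : 0 ≤ shrink k := by unfold shrink; positivity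

theorem shrink_lt_one (k : ℕ) : shrink k < 1 := by
  unfold shrink; rw [div_lt_one (by positivity)]; linarith

theorem shrink_le_succ (k : ℕ) : shrink k ≤ shrink (k + 1) := by
  unfold shrink
  rw [div_le_div_iff₀ (by positivity) (by positivity)]
  have : ((k - 1 : ℕ) : ℝ) ≤ ((k + 1 - 1 : ℕ) : ℝ) := by exact_mod_cast by omega
  nlinarith

/-- The simplices of the subdivision of `w` are contained in the image of `w` and smaller by the
factor `shrink k`. Their containment is what bounds, in the inductive step, the distance of their
vertices from the barycenter. -/
theorem subdiv_single_mem {k : ℕ} {w : Fin k → stdSimplex ℝ κ} {D : ℝ} (h : w ∈ small k κ D) :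
    subdiv k (Finsupp.single w 1) ∈ Finsupp.supported ℤ ℤ
      (small k κ (shrink k * D) ∩ {w' | ∀ j, w' j ∈ Set.range (convexComb w)}) := by
  induction k with
  | zero =>
    exact Finsupp.single_mem_supported _ _ ⟨fun i => i.elim0, fun i => i.elim0⟩
  | succ k ih =>
    have hD : 0 ≤ D := dist_nonneg.trans (h 0 0)
    rw [subdiv_single, bd_single, map_sum, map_sum]
    refine Submodule.sum_mem _ fun i _ => ?_
    rw [map_zsmul, map_zsmul]
    refine Submodule.smul_mem _ _ (lift_mem ?_ (ih (w := w ∘ i.succAbove) fun a b => h _ _))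
    rintro w' ⟨hw', hr⟩
    have hr' : ∀ j, w' j ∈ Set.range (convexComb w) := fun j => by
      obtain ⟨t, ht⟩ := hr j
      refine ⟨convexComb (fun a => stdSimplex.vertex (i.succAbove a)) t, ?_⟩
      rw [convexComb_convexComb, ← ht]
      simp only [convexComb_vertex]
      rfl
    have hb : ∀ j, dist (bary w) (w' j) ≤ shrink (k + 1) * D := fun j => by
      obtain ⟨t, ht⟩ := hr' j
      rw [dist_comm, ← ht]
      refine dist_convexComb_le (fun a => ?_) t
      rw [dist_comm]
      simpa [shrink] using dist_bary_le h a
    have hn : 0 ≤ shrink (k + 1) * D := mul_nonneg (shrink_nonneg _) hD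
    refine Finsupp.single_mem_supported _ _ ⟨fun a b => ?_, fun a => ?_⟩
    · refine Fin.cases ?_ (fun a => ?_) a <;> refine Fin.cases ?_ (fun b => ?_) b
      · simpa using hn
      · simpa using hb b
      · simpa [dist_comm] using hb a
      · simpa using (hw' a b).trans (mul_le_mul_of_nonneg_right (shrink_le_succ k) hD)
    · refine Fin.cases ?_ (fun a => ?_) a
      · exact ⟨_, rfl⟩
      · simpa using hr' a

theorem subdiv_mem_small {k : ℕ} {D : ℝ} {c : AffineChain k κ}
    (hc : c ∈ Finsupp.supported ℤ ℤ (small k κ D)) :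
    subdiv k c ∈ Finsupp.supported ℤ ℤ (small k κ (shrink k * D)) := by
  have h : subdiv (κ := κ) k = lift fun w => subdiv k (Finsupp.single w 1) :=
    hom_ext fun w => by simp
  rw [h]
  exact lift_mem (fun w hw => Finsupp.supported_mono Set.inter_subset_left
    (subdiv_single_mem hw)) hc

/-- The simplices of the iterated subdivisions of the standard simplex become arbitrarily small. -/
theorem exists_iterate_subdiv_mem_small (k : ℕ) (κ : Type*) [Fintype κ] {D : ℝ} (hD : 0 < D)
    (c : AffineChain k κ) :
    ∃ m : ℕ, (subdiv k)^[m] c ∈ Finsupp.supported ℤ ℤ (small k κ D) := by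
  obtain ⟨m, hm⟩ := exists_pow_lt_of_lt_one hD (shrink_lt_one k)
  have key : ∀ m : ℕ, (subdiv k)^[m] c ∈ Finsupp.supported ℤ ℤ (small k κ (shrink k ^ m * 1)) := by
    intro m
    induction m with
    | zero =>
      refine fun w _ i j => ?_
      rw [pow_zero, mul_one]
      exact (Metric.dist_le_diam_of_mem (bounded_stdSimplex κ) (w i).2 (w j).2).trans
        diam_stdSimplex_le
    | succ m ih =>
      rw [Function.iterate_succ_apply', pow_succ', mul_assoc]
      exact subdiv_mem_small ih
  refine ⟨m, Finsupp.supported_mono (fun w hw i j => (hw i j).trans ?_) (key m)⟩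
  rw [mul_one]
  exact hm.le

end AffineChain

end AffineSimplices

/-! ### Singular chains on maps from simplices -/

noncomputable section SingularChains

open AffineChain

variable {R : Type v} [Ring R]

/-- The topological simplex with `n` vertices, empty for `n = 0`. -/
abbrev Simplex (n : ℕ) := stdSimplex ℝ (Fin n)

/-- The inclusion of the face opposite to the `i`-th vertex. -/
abbrev faceMap {n : ℕ} (i : Fin (n + 1)) : C(Simplex n, Simplex (n + 1)) :=
  affineSimplex (faceVertices i)

namespace ConcreteChains

variable (M : Type u) [AddCommGroup M] [Module R M]
variable {X Y Z : Type u} [TopologicalSpace X] [TopologicalSpace Y] [TopologicalSpace Z]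
variable {κ ι : Type} [Fintype κ] [Fintype ι]

section Realize

variable (R)

/-- The singular chain in `X` obtained by composing an affine chain with a continuous map `τ` from
the standard simplex to `X`, as a linear map in the coefficient. -/
def realize {k : ℕ} (τ : C(stdSimplex ℝ κ, X)) :
    AffineChain k κ →+ (M →ₗ[R] (C(Simplex k, X) →₀ M)) :=
  lift fun w => Finsupp.lsingle (τ.comp (affineSimplex w))

variable {M}

theorem realize_single {k : ℕ} (τ : C(stdSimplex ℝ κ, X)) (w : Fin k → stdSimplex ℝ κ) (m : M) :
    realize R M τ (Finsupp.single w 1) m = Finsupp.single (τ.comp (affineSimplex w)) m := by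
  simp [realize]

/-- A singular simplex is the realization of the identity, the affine simplex on the vertices of the
standard simplex. This reduces identities between natural operators to affine chains. -/
theorem realize_vertex {k : ℕ} (σ : C(Simplex k, X)) (m : M) :
    realize R M σ (Finsupp.single stdSimplex.vertex 1) m = Finsupp.single σ m := by
  rw [realize_single]
  congr 1
  ext t : 1
  simp [convexComb_vertex_left]

theorem realize_push {k : ℕ} (τ : C(stdSimplex ℝ κ, X)) (v : ι → stdSimplex ℝ κ)
    (c : AffineChain k ι) (m : M) :
    realize R M τ (push k v c) m = realize R M (τ.comp (affineSimplex v)) c m := by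
  suffices h : (realize R M τ).comp (push k v) = realize R M (τ.comp (affineSimplex v)) from
    LinearMap.congr_fun (DFunLike.congr_fun h c) m
  refine hom_ext fun w => LinearMap.ext fun m => ?_
  rw [AddMonoidHom.comp_apply, push_single, realize_single, realize_single]
  congr 1
  ext t : 1
  simp [convexComb_convexComb]

variable (M) in
/-- The boundary operator on singular chains. In degree `0` it is the augmentation. -/
def boundary (n : ℕ) : (C(Simplex (n + 1), X) →₀ M) →ₗ[R] (C(Simplex n, X) →₀ M) :=
  Finsupp.lsum ℕ fun σ => ∑ i : Fin (n + 1), (-1 : ℤ) ^ (i : ℕ) •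
    Finsupp.lsingle (σ.comp (faceMap i))

theorem boundary_single {n : ℕ} (σ : C(Simplex (n + 1), X)) (m : M) :
    boundary R M n (Finsupp.single σ m) =
      ∑ i : Fin (n + 1), (-1 : ℤ) ^ (i : ℕ) • Finsupp.single (σ.comp (faceMap i)) m := by
  simp [boundary]

theorem boundary_realize {k : ℕ} (τ : C(stdSimplex ℝ κ, X)) (c : AffineChain (k + 1) κ) (m : M) :
    boundary R M k (realize R M τ c m) = realize R M τ (bd k c) m := by
  suffices h : (AddMonoidHom.mk' (fun φ : M →ₗ[R] (C(Simplex (k + 1), X) →₀ M) =>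
      (boundary R M k).comp φ) fun a b => LinearMap.comp_add _ _ _).comp (realize R M τ) =
      (realize R M τ).comp (bd k) from LinearMap.congr_fun (DFunLike.congr_fun h c) m
  refine hom_ext fun w => LinearMap.ext fun m => ?_
  change boundary R M k (realize R M τ (Finsupp.single w 1) m) =
    realize R M τ (bd k (Finsupp.single w 1)) m
  rw [realize_single, boundary_single, bd_single, map_sum, LinearMap.sum_apply]
  refine Finset.sum_congr rfl fun i _ => ?_
  rw [map_zsmul, LinearMap.smul_apply, realize_single]
  congr 2
  ext t : 1
  simp only [ContinuousMap.comp_apply, affineSimplex_apply, convexComb_convexComb, faceVertices,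
    convexComb_vertex]
  rfl

theorem boundary_boundary {n : ℕ} (z : C(Simplex (n + 2), X) →₀ M) :
    boundary R M n (boundary R M (n + 1) z) = 0 := by
  induction z using Finsupp.induction_linear with
  | zero => simp
  | add a b ha hb => rw [map_add, map_add, ha, hb, add_zero]
  | single σ m =>
    rw [← realize_vertex R, boundary_realize, boundary_realize, bd_bd, map_zero,
      LinearMap.zero_apply]

theorem mapDomain_realize {k : ℕ} (f : C(X, Y)) (τ : C(stdSimplex ℝ κ, X))
    (c : AffineChain k κ) (m : M) :
    Finsupp.lmapDomain M R f.comp (realize R M τ c m) = realize R M (f.comp τ) c m := by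
  suffices h : (AddMonoidHom.mk' (fun φ : M →ₗ[R] (C(Simplex k, X) →₀ M) =>
      (Finsupp.lmapDomain M R f.comp).comp φ) fun a b => LinearMap.comp_add _ _ _).comp
        (realize R M τ) = realize R M (f.comp τ) from
    LinearMap.congr_fun (DFunLike.congr_fun h c) m
  refine hom_ext fun w => LinearMap.ext fun m => ?_
  change Finsupp.lmapDomain M R f.comp (realize R M τ (Finsupp.single w 1) m) = _
  rw [realize_single, realize_single, Finsupp.lmapDomain_apply, Finsupp.mapDomain_single]
  rfl

theorem boundary_mapDomain {n : ℕ} (f : C(X, Y)) (z : C(Simplex (n + 1), X) →₀ M) :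
    boundary R M n (Finsupp.lmapDomain M R f.comp z) =
      Finsupp.lmapDomain M R f.comp (boundary R M n z) := by
  induction z using Finsupp.induction_linear with
  | zero => simp
  | add a b ha hb => rw [map_add, map_add, map_add, map_add, ha, hb]
  | single σ m =>
    rw [← realize_vertex R, boundary_realize, mapDomain_realize, mapDomain_realize,
      boundary_realize]

/-! ### Barycentric subdivision of singular chains -/

variable (M) in
/-- Barycentric subdivision of singular chains. -/
def subdivision (n : ℕ) : (C(Simplex n, X) →₀ M) →ₗ[R] (C(Simplex n, X) →₀ M) :=
  Finsupp.lsum ℕ fun σ => realize R M σ (subdiv n (Finsupp.single stdSimplex.vertex 1))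

theorem subdivision_single {n : ℕ} (σ : C(Simplex n, X)) (m : M) :
    subdivision R M n (Finsupp.single σ m) =
      realize R M σ (subdiv n (Finsupp.single stdSimplex.vertex 1)) m := by
  simp [subdivision]

theorem push_vertex {k : ℕ} (w : Fin k → stdSimplex ℝ κ) :
    push k w (Finsupp.single stdSimplex.vertex 1) = Finsupp.single w 1 := by
  rw [push_single]
  simp only [convexComb_vertex]

theorem subdivision_realize {k : ℕ} (τ : C(stdSimplex ℝ κ, X)) (c : AffineChain k κ) (m : M) :
    subdivision R M k (realize R M τ c m) = realize R M τ (subdiv k c) m := by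
  suffices h : (AddMonoidHom.mk' (fun φ : M →ₗ[R] (C(Simplex k, X) →₀ M) =>
      (subdivision R M k).comp φ) fun a b => LinearMap.comp_add _ _ _).comp
        (realize R M τ) = (realize R M τ).comp (subdiv k) from
    LinearMap.congr_fun (DFunLike.congr_fun h c) m
  refine hom_ext fun w => LinearMap.ext fun m => ?_
  change subdivision R M k (realize R M τ (Finsupp.single w 1) m) =
    realize R M τ (subdiv k (Finsupp.single w 1)) m
  rw [realize_single, subdivision_single, ← realize_push, ← subdiv_push, push_vertex]

theorem boundary_subdivision {n : ℕ} (z : C(Simplex (n + 1), X) →₀ M) :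
    boundary R M n (subdivision R M (n + 1) z) = subdivision R M n (boundary R M n z) := by
  induction z using Finsupp.induction_linear with
  | zero => simp
  | add a b ha hb => rw [map_add, map_add, map_add, map_add, ha, hb]
  | single σ m =>
    rw [← realize_vertex R, boundary_realize, subdivision_realize, boundary_realize,
      subdivision_realize, bd_subdiv]

theorem iterate_subdivision_realize {k : ℕ} (τ : C(stdSimplex ℝ κ, X)) (c : AffineChain k κ)
    (m : M) (j : ℕ) :
    (subdivision R M k)^[j] (realize R M τ c m) = realize R M τ ((subdiv k)^[j] c) m := by
  induction j with
  | zero => rfl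
  | succ j ih => rw [Function.iterate_succ_apply', ih, subdivision_realize,
      Function.iterate_succ_apply']

/-! ### The prism operator of a homotopy -/

theorem convexComb_const (x : stdSimplex ℝ κ) (t : stdSimplex ℝ ι) :
    convexComb (fun _ => x) t = x := by
  ext a
  simp [convexComb_apply, ← Finset.sum_mul]

variable {f g : C(X, Y)} [DecidableEq κ] [DecidableEq ι]

/-- The map from the prism on the standard simplex on `κ` to `Y` obtained from a homotopy between
maps from `X` to `Y` and a map from the standard simplex to `X`. -/
def prismSimplex (H : f.Homotopy g) (σ : C(stdSimplex ℝ κ, X)) :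
    C(stdSimplex ℝ (κ × Fin 2), Y) :=
  H.toContinuousMap.comp (ContinuousMap.prodMk
    ((stdSimplexHomeomorphUnitInterval : C(stdSimplex ℝ (Fin 2), unitInterval)).comp
      (affineSimplex fun p => stdSimplex.vertex p.2))
    (σ.comp (affineSimplex fun p => stdSimplex.vertex p.1)))

theorem prismSimplex_apply (H : f.Homotopy g) (σ : C(stdSimplex ℝ κ, X))
    (t : stdSimplex ℝ (κ × Fin 2)) : prismSimplex H σ t =
      H (stdSimplexHomeomorphUnitInterval (convexComb (fun p => stdSimplex.vertex p.2) t),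
        σ (convexComb (fun p => stdSimplex.vertex p.1) t)) := rfl

theorem prismSimplex_comp_prismMap (H : f.Homotopy g) (σ : C(stdSimplex ℝ κ, X))
    (v : ι → stdSimplex ℝ κ) :
    (prismSimplex H σ).comp (affineSimplex (prismMap v)) =
      prismSimplex H (σ.comp (affineSimplex v)) := by
  ext t : 1
  simp only [ContinuousMap.comp_apply, prismSimplex_apply, affineSimplex_apply,
    convexComb_convexComb, prismMap, prismEnd, convexComb_vertex, convexComb_const,
    convexComb_vertex_left]

theorem prismSimplex_comp_zero (H : f.Homotopy g) (σ : C(stdSimplex ℝ κ, X)) :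
    (prismSimplex H σ).comp (affineSimplex (prismEnd κ 0)) = f.comp σ := by
  ext t : 1
  simp only [ContinuousMap.comp_apply, prismSimplex_apply, affineSimplex_apply,
    convexComb_convexComb, prismEnd, convexComb_vertex, convexComb_const,
    convexComb_vertex_left]
  exact H.map_zero_left _

theorem prismSimplex_comp_one (H : f.Homotopy g) (σ : C(stdSimplex ℝ κ, X)) :
    (prismSimplex H σ).comp (affineSimplex (prismEnd κ 1)) = g.comp σ := by
  ext t : 1
  simp only [ContinuousMap.comp_apply, prismSimplex_apply, affineSimplex_apply,
    convexComb_convexComb, prismEnd, convexComb_vertex, convexComb_const,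
    convexComb_vertex_left]
  exact H.map_one_left _

variable (M) in
/-- The prism operator of a homotopy from `f` to `g`: a chain homotopy between the map induced by
`f` and the composition of the map induced by `g` with subdivision. -/
def prismOperator (H : f.Homotopy g) (n : ℕ) :
    (C(Simplex n, X) →₀ M) →ₗ[R] (C(Simplex (n + 1), Y) →₀ M) :=
  Finsupp.lsum ℕ fun σ =>
    realize R M (prismSimplex H σ) (prism n (Finsupp.single stdSimplex.vertex 1))

theorem prismOperator_single (H : f.Homotopy g) {n : ℕ} (σ : C(Simplex n, X)) (m : M) :
    prismOperator R M H n (Finsupp.single σ m) =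
      realize R M (prismSimplex H σ) (prism n (Finsupp.single stdSimplex.vertex 1)) m := by
  simp [prismOperator]

theorem prismOperator_realize (H : f.Homotopy g) {k : ℕ} (τ : C(stdSimplex ℝ κ, X))
    (c : AffineChain k κ) (m : M) :
    prismOperator R M H k (realize R M τ c m) =
      realize R M (prismSimplex H τ) (prism k c) m := by
  suffices h : (AddMonoidHom.mk' (fun φ : M →ₗ[R] (C(Simplex k, X) →₀ M) =>
      (prismOperator R M H k).comp φ) fun a b => LinearMap.comp_add _ _ _).comp
        (realize R M τ) = (realize R M (prismSimplex H τ)).comp (prism k) from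
    LinearMap.congr_fun (DFunLike.congr_fun h c) m
  refine hom_ext fun w => LinearMap.ext fun m => ?_
  change prismOperator R M H k (realize R M τ (Finsupp.single w 1) m) =
    realize R M (prismSimplex H τ) (prism k (Finsupp.single w 1)) m
  rw [realize_single, prismOperator_single, ← prismSimplex_comp_prismMap, ← realize_push,
    ← prism_push, push_vertex]

theorem boundary_prismOperator_zero (H : f.Homotopy g) (z : C(Simplex 0, X) →₀ M) :
    boundary R M 0 (prismOperator R M H 0 z) =
      Finsupp.lmapDomain M R g.comp (subdivision R M 0 z) - Finsupp.lmapDomain M R f.comp z := by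
  induction z using Finsupp.induction_linear with
  | zero => simp
  | add a b ha hb => simp only [map_add, ha, hb]; abel
  | single σ m =>
    rw [← realize_vertex R, subdivision_realize, mapDomain_realize, mapDomain_realize,
      prismOperator_realize, boundary_realize, bd_prism_zero, map_sub, LinearMap.sub_apply,
      realize_push, realize_push, prismSimplex_comp_zero, prismSimplex_comp_one]

theorem boundary_prismOperator_succ (H : f.Homotopy g) {n : ℕ}
    (z : C(Simplex (n + 1), X) →₀ M) :
    boundary R M (n + 1) (prismOperator R M H (n + 1) z) =
      Finsupp.lmapDomain M R g.comp (subdivision R M (n + 1) z) -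
        Finsupp.lmapDomain M R f.comp z - prismOperator R M H n (boundary R M n z) := by
  induction z using Finsupp.induction_linear with
  | zero => simp
  | add a b ha hb => simp only [map_add, ha, hb]; abel
  | single σ m =>
    rw [← realize_vertex R, subdivision_realize, mapDomain_realize, mapDomain_realize,
      prismOperator_realize, boundary_realize, boundary_realize, bd_prism_succ, map_sub, map_sub,
      LinearMap.sub_apply, LinearMap.sub_apply, realize_push, realize_push, prismSimplex_comp_zero,
      prismSimplex_comp_one, prismOperator_realize]

end Realize

end ConcreteChains

end SingularChains

/-! ### The augmented singular complex and homotopy invariance -/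

noncomputable section ConcreteComplex

open AffineChain ConcreteChains

variable {R : Type v} [Ring R]

/-- A chain homotopy between morphisms of chain complexes of modules, from a family of maps raising
the degree by one. -/
def chainHomotopyOfSucc {C D : ChainComplex (ModuleCat.{u} R) ℕ} {f g : C ⟶ D}
    (h : ∀ n, C.X n ⟶ D.X (n + 1)) (h0 : f.f 0 = h 0 ≫ D.d 1 0 + g.f 0)
    (h1 : ∀ n, f.f (n + 1) = C.d (n + 1) n ≫ h n + h (n + 1) ≫ D.d (n + 2) (n + 1) + g.f (n + 1)) :
    Homotopy f g where
  hom i j := if hij : i + 1 = j then h i ≫ eqToHom (by rw [hij]) else 0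
  zero i j hij := dif_neg hij
  comm n := by
    cases n with
    | zero => simp [h0, dNext, prevD]
    | succ n =>
      rw [dNext_eq _ (show (ComplexShape.down ℕ).Rel (n + 1) n from rfl),
        prevD_eq _ (show (ComplexShape.down ℕ).Rel (n + 2) (n + 1) from rfl)]
      simp [h1]

variable (M : ModuleCat.{u} R)
variable {X Y Z : Type u} [TopologicalSpace X] [TopologicalSpace Y] [TopologicalSpace Z]

/-- The augmented singular chain complex of `X` with coefficients in `M`. In degree `n` it consists
of the finitely supported `M`-valued functions on the set of continuous maps to `X` from the simplex
with `n` vertices, so that degrees are shifted by one and degree `0` is that of the augmentation. -/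
def concreteChains (X : Type u) [TopologicalSpace X] : ChainComplex (ModuleCat.{u} R) ℕ :=
  ChainComplex.of (fun n => ModuleCat.of R (C(Simplex n, X) →₀ M))
    (fun n => ModuleCat.ofHom (boundary R M n)) fun _ =>
      ModuleCat.hom_ext (LinearMap.ext fun z => boundary_boundary R z)

theorem concreteChains_d (n : ℕ) :
    (concreteChains M X).d (n + 1) n = ModuleCat.ofHom (boundary R M n) := by
  simp [concreteChains]

/-- The chain map induced by a continuous map. -/
def concreteMap (f : C(X, Y)) : concreteChains M X ⟶ concreteChains M Y :=
  ChainComplex.ofHom (fun n => ModuleCat.ofHom (Finsupp.lmapDomain M R f.comp)) fun n => by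
    rw [concreteChains_d, concreteChains_d]
    exact ModuleCat.hom_ext (LinearMap.ext fun z => boundary_mapDomain R f z)

theorem concreteMap_comp (f : C(X, Y)) (g : C(Y, Z)) :
    concreteMap M f ≫ concreteMap M g = concreteMap M (g.comp f) := by
  ext n : 1
  refine ModuleCat.hom_ext (LinearMap.ext fun z => ?_)
  exact (Finsupp.mapDomain_comp (f := f.comp) (g := g.comp)).symm

theorem concreteMap_id : concreteMap M (ContinuousMap.id X) = 𝟙 _ := by
  ext n : 1
  exact ModuleCat.hom_ext (LinearMap.ext fun z => Finsupp.mapDomain_id)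

/-- Barycentric subdivision as a chain map. -/
def subdivisionMap (X : Type u) [TopologicalSpace X] : concreteChains M X ⟶ concreteChains M X :=
  ChainComplex.ofHom (fun n => ModuleCat.ofHom (subdivision R M n)) fun n => by
    rw [concreteChains_d]
    exact ModuleCat.hom_ext (LinearMap.ext fun z => boundary_subdivision R z)

/-- Homotopic maps induce chain homotopic maps up to subdivision of the second one. -/
def homotopySubdivision {f g : C(X, Y)} (H : f.Homotopy g) :
    Homotopy (subdivisionMap M X ≫ concreteMap M g) (concreteMap M f) :=
  chainHomotopyOfSucc (fun n => ModuleCat.ofHom (prismOperator R M H n))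
    (by
      refine ModuleCat.hom_ext (LinearMap.ext fun z => ?_)
      rw [concreteChains_d]
      refine eq_add_of_sub_eq ?_
      exact (boundary_prismOperator_zero R H z).symm)
    fun n => by
      refine ModuleCat.hom_ext (LinearMap.ext fun z => ?_)
      rw [concreteChains_d, concreteChains_d]
      refine eq_add_of_sub_eq (eq_add_of_sub_eq' ?_)
      exact (boundary_prismOperator_succ R H z).symm

/-- Homotopic maps agree on homology, since both agree with the subdivision of the second. -/
theorem homologyMap_concreteMap_eq {f g : C(X, Y)} (h : f.Homotopic g) (n : ℕ) :
    HomologicalComplex.homologyMap (concreteMap M f) n =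
      HomologicalComplex.homologyMap (concreteMap M g) n :=
  h.elim fun H => ((homotopySubdivision M H).homologyMap_eq n).symm.trans
    ((homotopySubdivision M (ContinuousMap.Homotopy.refl g)).homologyMap_eq n)

/-- A homotopy equivalence induces isomorphisms on homology. -/
theorem isIso_homologyMap_concreteMap (f : C(X, Y)) (g : C(Y, X))
    (hfg : (g.comp f).Homotopic (.id X)) (hgf : (f.comp g).Homotopic (.id Y)) (n : ℕ) :
    IsIso (HomologicalComplex.homologyMap (concreteMap M f) n) := by
  refine ⟨HomologicalComplex.homologyMap (concreteMap M g) n, ?_, ?_⟩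
  · rw [← HomologicalComplex.homologyMap_comp, concreteMap_comp, homologyMap_concreteMap_eq M hfg,
      concreteMap_id, HomologicalComplex.homologyMap_id]
  · rw [← HomologicalComplex.homologyMap_comp, concreteMap_comp, homologyMap_concreteMap_eq M hgf,
      concreteMap_id, HomologicalComplex.homologyMap_id]

/-- On a point, the terms of the alternating sum that defines the boundary cancel in pairs. -/
theorem boundary_of_subsingleton [Subsingleton X] (x : X) (n : ℕ)
    (z : C(Simplex (n + 1), X) →₀ M) : boundary R M n z =
      if Even n then Finsupp.lmapDomain M R (fun _ => ContinuousMap.const _ x) z else 0 := by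
  induction z using Finsupp.induction_linear with
  | zero => simp
  | add a b ha hb => rw [map_add, ha, hb]; split_ifs <;> simp only [map_add, add_zero]
  | single σ m =>
    have h : ∀ i : Fin (n + 1), σ.comp (faceMap i) = ContinuousMap.const _ x := fun i =>
      ContinuousMap.ext fun t => Subsingleton.elim _ _
    rw [boundary_single]
    simp only [h, ← Finset.sum_smul]
    rw [Fin.sum_neg_one_pow]
    by_cases hn : Even n
    · simp [hn, Nat.even_add_one]
    · simp [hn, Nat.even_add_one]

/-- The contraction of the augmented singular chain complex of a point. -/
def pointContraction (X : Type u) [TopologicalSpace X] [Unique X] (n : ℕ) :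
    (C(Simplex n, X) →₀ M) →ₗ[R] (C(Simplex (n + 1), X) →₀ M) :=
  if Even n then Finsupp.lmapDomain M R fun _ => ContinuousMap.const _ default else 0

theorem lmapDomain_const_lmapDomain_const [Unique X] (n k : ℕ) (z : C(Simplex n, X) →₀ M) :
    Finsupp.lmapDomain M R (fun _ : C(Simplex k, X) =>
        (ContinuousMap.const _ default : C(Simplex n, X)))
      (Finsupp.lmapDomain M R (fun _ : C(Simplex n, X) =>
        (ContinuousMap.const _ default : C(Simplex k, X))) z) = z := by
  refine Finsupp.mapDomain_comp.symm.trans ?_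
  refine Eq.trans (congrArg (fun f => Finsupp.mapDomain f z) (funext fun σ => ?_))
      Finsupp.mapDomain_id
  exact ContinuousMap.ext fun t => Subsingleton.elim _ _

theorem boundary_pointContraction_zero [Unique X] (z : C(Simplex 0, X) →₀ M) :
    boundary R M 0 (pointContraction M X 0 z) = z := by
  rw [boundary_of_subsingleton M (default : X), pointContraction, if_pos Even.zero,
    if_pos Even.zero, lmapDomain_const_lmapDomain_const]

theorem boundary_pointContraction_succ [Unique X] (n : ℕ) (z : C(Simplex (n + 1), X) →₀ M) :
    pointContraction M X n (boundary R M n z) +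
      boundary R M (n + 1) (pointContraction M X (n + 1) z) = z := by
  rw [boundary_of_subsingleton M (default : X), boundary_of_subsingleton M (default : X),
    pointContraction, pointContraction]
  by_cases hn : Even n
  · rw [if_pos hn, if_pos hn, if_neg (by simpa [Nat.even_add_one] using hn), add_zero,
      lmapDomain_const_lmapDomain_const]
  · have hn' : Even (n + 1) := by simpa [Nat.even_add_one] using hn
    rw [if_neg hn, if_neg hn, if_pos hn', if_pos hn', map_zero, zero_add,
      lmapDomain_const_lmapDomain_const]

/-- The augmented singular chain complex of a point is contractible. -/
def homotopyOfUnique [Unique X] : Homotopy (𝟙 (concreteChains M X)) 0 :=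
  chainHomotopyOfSucc (fun n => ModuleCat.ofHom (pointContraction M X n))
    (by
      refine ModuleCat.hom_ext (LinearMap.ext fun z => ?_)
      rw [concreteChains_d, HomologicalComplex.zero_f, add_zero]
      exact (boundary_pointContraction_zero M z).symm)
    fun n => by
      refine ModuleCat.hom_ext (LinearMap.ext fun z => ?_)
      rw [concreteChains_d, concreteChains_d, HomologicalComplex.zero_f, add_zero]
      exact (boundary_pointContraction_succ M n z).symm

/-- The reduced homology of a contractible space vanishes: the identity induces the same map as a
constant map, which factors through a point. -/
theorem acyclic_concreteChains (x : X) (h : (ContinuousMap.id X).Homotopic (.const X x)) :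
    (concreteChains M X).Acyclic := by
  intro n
  rw [HomologicalComplex.exactAt_iff_isZero_homology, Limits.IsZero.iff_id_eq_zero,
    ← HomologicalComplex.homologyMap_id, ← concreteMap_id, homologyMap_concreteMap_eq M h]
  have hc : ContinuousMap.const X x = (ContinuousMap.const PUnit.{u + 1} x).comp
    (ContinuousMap.const X PUnit.unit) := rfl
  rw [hc, ← concreteMap_comp, ← Category.id_comp (concreteMap M (ContinuousMap.const _ x)),
    HomologicalComplex.homologyMap_comp, HomologicalComplex.homologyMap_comp,
    (homotopyOfUnique M).homologyMap_eq]
  simp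

/-- In degree `0`, which computes the reduced homology in degree `-1`, the homology of a nonempty
space vanishes. -/
theorem isZero_homology_zero (x : X) : Limits.IsZero ((concreteChains M X).homology 0) := by
  rw [← HomologicalComplex.exactAt_iff_isZero_homology,
    HomologicalComplex.exactAt_iff' _ 1 0 0 (by simp) (by simp), ShortComplex.moduleCat_exact_iff]
  intro z hz
  clear hz
  change ∃ y, (concreteChains M X).d 1 0 y = z
  rw [concreteChains_d]
  refine ⟨Finsupp.lmapDomain M R (fun _ => ContinuousMap.const _ x) z, ?_⟩
  change boundary R M 0 (Finsupp.lmapDomain M R (fun _ => ContinuousMap.const _ x) z) = z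
  induction z using Finsupp.induction_linear with
  | zero => simp
  | add a b ha hb => rw [map_add, map_add, ha, hb]
  | single σ m =>
    rw [Finsupp.lmapDomain_apply, Finsupp.mapDomain_single, boundary_single]
    simp only [Fin.sum_univ_succ, Fin.sum_univ_zero, add_zero, Fin.val_zero, pow_zero, one_smul]
    congr 1
    exact ContinuousMap.ext fun t => (stdSimplex_of_isEmpty_index ℝ (Fin 0)).subset t.2 |>.elim

end ConcreteComplex

/-! ### Subcomplexes, products and split long exact sequences -/

noncomputable section HomologicalAlgebra

variable {R : Type v} [Ring R]

theorem shortExact_of_exact_apply {S : ShortComplex (ChainComplex (ModuleCat.{u} R) ℕ)}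
    (hf : ∀ n, Function.Injective (S.f.f n)) (hg : ∀ n, Function.Surjective (S.g.f n))
    (hex : ∀ n (z : S.X₂.X n), S.g.f n z = 0 → ∃ y, S.f.f n y = z) : S.ShortExact :=
  HomologicalComplex.shortExact_of_degreewise_shortExact S fun n =>
    { exact := (ShortComplex.moduleCat_exact_iff _).2 (hex n)
      mono_f := (ModuleCat.mono_iff_injective _).2 (hf n)
      epi_g := (ModuleCat.epi_iff_surjective _).2 (hg n) }

theorem isIso_homologyMap_of_acyclic {S : ShortComplex (ChainComplex (ModuleCat.{u} R) ℕ)}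
    (hS : S.ShortExact) (h : S.X₃.Acyclic) (n : ℕ) :
    IsIso (HomologicalComplex.homologyMap S.f n) := by
  have h0 : ∀ i, Limits.IsZero (S.X₃.homology i) := fun i =>
    (HomologicalComplex.exactAt_iff_isZero_homology _ _).1 (h i)
  have h1 := (hS.homology_exact₁ (n + 1) n rfl).mono_g ((h0 _).eq_of_src _ _)
  have h2 := (hS.homology_exact₂ n).epi_f ((h0 _).eq_of_tgt _ _)
  exact isIso_of_mono_of_epi _

/-- If a short exact sequence of chain complexes has a second map that splits on homology, the
long exact sequence breaks up into split short exact sequences. -/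
theorem nonempty_homology_equiv_prod {S : ShortComplex (ChainComplex (ModuleCat.{u} R) ℕ)}
    (hS : S.ShortExact) (h : ∀ n, IsSplitMono (HomologicalComplex.homologyMap S.g n)) (n : ℕ) :
    Nonempty (S.X₃.homology (n + 1) ≃ₗ[R] S.X₂.homology (n + 1) × S.X₁.homology n) := by
  have hf : HomologicalComplex.homologyMap S.f n = 0 := by
    have := h n
    rw [← cancel_mono (HomologicalComplex.homologyMap S.g n), ← HomologicalComplex.homologyMap_comp,
      S.zero, HomologicalComplex.homologyMap_zero, Limits.zero_comp]
  have hδ : Epi (hS.δ (n + 1) n rfl) := (hS.homology_exact₁ (n + 1) n rfl).epi_f hf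
  have := h (n + 1)
  have sp := ShortComplex.Splitting.ofExactOfRetraction _ (hS.homology_exact₃ (n + 1) n rfl)
    (retraction (HomologicalComplex.homologyMap S.g (n + 1))) (IsSplitMono.id _) hδ
  exact ⟨(sp.isoBinaryBiproduct ≪≫ ModuleCat.biprodIsoProd _ _).toLinearEquiv⟩

section Subcomplex

variable (C D : ChainComplex (ModuleCat.{u} R) ℕ) (N : ∀ n, Submodule R (C.X n))
  (hN : ∀ n, ∀ z ∈ N (n + 1), C.d (n + 1) n z ∈ N n)

/-- The subcomplex given by submodules stable under the differential. -/
def subcomplex : ChainComplex (ModuleCat.{u} R) ℕ :=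
  ChainComplex.of (fun n => ModuleCat.of R (N n))
    (fun n => ModuleCat.ofHom ((C.d (n + 1) n).hom.restrict (hN n))) fun n =>
      ModuleCat.hom_ext (LinearMap.ext fun z => Subtype.ext
        (LinearMap.congr_fun (congrArg ModuleCat.Hom.hom (C.d_comp_d (n + 2) (n + 1) n)) z.1))

theorem subcomplex_d (n : ℕ) : (subcomplex C N hN).d (n + 1) n =
    ModuleCat.ofHom ((C.d (n + 1) n).hom.restrict (hN n)) := by
  simp [subcomplex]

/-- The inclusion of a subcomplex. -/
def subcomplexι : subcomplex C N hN ⟶ C :=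
  ChainComplex.ofHom (fun n => ModuleCat.ofHom (N n).subtype) fun n => by
    rw [subcomplex_d]
    exact ModuleCat.hom_ext (LinearMap.ext fun z => rfl)

/-- The quotient by a subcomplex. -/
def quotientComplex : ChainComplex (ModuleCat.{u} R) ℕ :=
  ChainComplex.of (fun n => ModuleCat.of R (C.X n ⧸ N n))
    (fun n => ModuleCat.ofHom ((N (n + 1)).mapQ (N n) (C.d (n + 1) n).hom (hN n))) fun n =>
      ModuleCat.hom_ext (Submodule.linearMap_qext _ (LinearMap.ext fun z => congrArg (N n).mkQ
        (LinearMap.congr_fun (congrArg ModuleCat.Hom.hom (C.d_comp_d (n + 2) (n + 1) n)) z)))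

theorem quotientComplex_d (n : ℕ) : (quotientComplex C N hN).d (n + 1) n =
    ModuleCat.ofHom ((N (n + 1)).mapQ (N n) (C.d (n + 1) n).hom (hN n)) := by
  simp [quotientComplex]

/-- The projection to the quotient by a subcomplex. -/
def quotientComplexπ : C ⟶ quotientComplex C N hN :=
  ChainComplex.ofHom (fun n => ModuleCat.ofHom (N n).mkQ) fun n => by
    rw [quotientComplex_d]
    exact ModuleCat.hom_ext (LinearMap.ext fun z => rfl)

/-- The inclusion of a subcomplex is an isomorphism on homology if every relative cycle is
homologous to a chain of the subcomplex. -/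
theorem isIso_homologyMap_subcomplexι (h0 : ∀ z : C.X 0, ∃ y, z - C.d 1 0 y ∈ N 0)
    (h1 : ∀ n, ∀ z : C.X (n + 1), C.d (n + 1) n z ∈ N n →
      ∃ y, z - C.d (n + 2) (n + 1) y ∈ N (n + 1)) (n : ℕ) :
    IsIso (HomologicalComplex.homologyMap (subcomplexι C N hN) n) := by
  have w : subcomplexι C N hN ≫ quotientComplexπ C N hN = 0 := by
    ext n : 1
    exact ModuleCat.hom_ext (LinearMap.ext fun z => (Submodule.Quotient.mk_eq_zero _).2 z.2)
  have hS : (ShortComplex.mk _ _ w).ShortExact := shortExact_of_exact_apply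
    (fun n => Subtype.val_injective) (fun n => (N n).mkQ_surjective)
    (fun n z hz => ⟨⟨z, (Submodule.Quotient.mk_eq_zero _).1 hz⟩, rfl⟩)
  refine isIso_homologyMap_of_acyclic hS (fun k => ?_) n
  change (quotientComplex C N hN).ExactAt k
  cases k with
  | zero =>
    rw [HomologicalComplex.exactAt_iff' _ 1 0 0 (by simp) (by simp),
      ShortComplex.moduleCat_exact_iff]
    intro z _
    obtain ⟨z, rfl⟩ := (N 0).mkQ_surjective z
    obtain ⟨y, hy⟩ := h0 z
    refine ⟨(N 1).mkQ y, ?_⟩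
    change (quotientComplex C N hN).d 1 0 _ = _
    rw [quotientComplex_d]
    exact ((Submodule.Quotient.eq _).2 hy).symm
  | succ k =>
    rw [HomologicalComplex.exactAt_iff' _ (k + 2) (k + 1) k (by simp) (by simp),
      ShortComplex.moduleCat_exact_iff]
    intro z hz
    obtain ⟨z, rfl⟩ := (N (k + 1)).mkQ_surjective z
    change (quotientComplex C N hN).d (k + 1) k _ = _ at hz
    rw [quotientComplex_d] at hz
    obtain ⟨y, hy⟩ := h1 k z ((Submodule.Quotient.mk_eq_zero _).1 hz)
    refine ⟨(N (k + 2)).mkQ y, ?_⟩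
    change (quotientComplex C N hN).d (k + 2) (k + 1) _ = _
    rw [quotientComplex_d]
    exact ((Submodule.Quotient.eq _).2 hy).symm

/-- The degreewise product of two chain complexes. -/
def prodComplex : ChainComplex (ModuleCat.{u} R) ℕ :=
  ChainComplex.of (fun n => ModuleCat.of R (C.X n × D.X n))
    (fun n => ModuleCat.ofHom ((C.d (n + 1) n).hom.prodMap (D.d (n + 1) n).hom)) fun n =>
      ModuleCat.hom_ext (LinearMap.ext fun z => Prod.ext
        (LinearMap.congr_fun (congrArg ModuleCat.Hom.hom (C.d_comp_d (n + 2) (n + 1) n)) z.1)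
        (LinearMap.congr_fun (congrArg ModuleCat.Hom.hom (D.d_comp_d (n + 2) (n + 1) n)) z.2))

theorem prodComplex_d (n : ℕ) : (prodComplex C D).d (n + 1) n =
    ModuleCat.ofHom ((C.d (n + 1) n).hom.prodMap (D.d (n + 1) n).hom) := by
  simp [prodComplex]

/-- The inclusion of the first factor of a product of chain complexes. -/
def prodInl : C ⟶ prodComplex C D :=
  ChainComplex.ofHom (fun n => ModuleCat.ofHom (LinearMap.inl R (C.X n) (D.X n))) fun n => by
    rw [prodComplex_d]
    exact ModuleCat.hom_ext (LinearMap.ext fun z => Prod.ext rfl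
      (map_zero (D.d (n + 1) n).hom))

theorem isIso_homologyMap_prodInl (h : D.Acyclic) (n : ℕ) :
    IsIso (HomologicalComplex.homologyMap (prodInl C D) n) := by
  let p : prodComplex C D ⟶ D :=
    ChainComplex.ofHom (fun n => ModuleCat.ofHom (LinearMap.snd R (C.X n) (D.X n))) fun n => by
      rw [prodComplex_d]
      exact ModuleCat.hom_ext (LinearMap.ext fun z => rfl)
  have w : prodInl C D ≫ p = 0 := by
    ext n : 1
    exact ModuleCat.hom_ext (LinearMap.ext fun z => rfl)
  have hS : (ShortComplex.mk _ _ w).ShortExact := shortExact_of_exact_apply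
    (fun n => LinearMap.inl_injective) (fun n => LinearMap.snd_surjective)
    (fun n z hz => ⟨z.1, Prod.ext rfl (Eq.symm hz)⟩)
  exact isIso_homologyMap_of_acyclic hS h n

variable {C D}

/-- The map into a product of chain complexes given by its components. -/
def prodLift {E : ChainComplex (ModuleCat.{u} R) ℕ} (f : E ⟶ C) (g : E ⟶ D) :
    E ⟶ prodComplex C D :=
  ChainComplex.ofHom (fun n => ModuleCat.ofHom ((f.f n).hom.prod (g.f n).hom)) fun n => by
    rw [prodComplex_d]
    exact ModuleCat.hom_ext (LinearMap.ext fun z => Prod.ext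
      (LinearMap.congr_fun (congrArg ModuleCat.Hom.hom (f.comm (n + 1) n)) z)
      (LinearMap.congr_fun (congrArg ModuleCat.Hom.hom (g.comm (n + 1) n)) z))

/-- The map from a product of chain complexes given by its restrictions to the factors. -/
def prodDesc {E : ChainComplex (ModuleCat.{u} R) ℕ} (f : C ⟶ E) (g : D ⟶ E) :
    prodComplex C D ⟶ E :=
  ChainComplex.ofHom (fun n => ModuleCat.ofHom ((f.f n).hom.coprod (g.f n).hom)) fun n => by
    rw [prodComplex_d]
    refine ModuleCat.hom_ext (LinearMap.ext fun z => ?_)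
    exact (map_add (E.d (n + 1) n).hom _ _).trans (congrArg₂ (· + ·)
      (LinearMap.congr_fun (congrArg ModuleCat.Hom.hom (f.comm (n + 1) n)) z.1)
      (LinearMap.congr_fun (congrArg ModuleCat.Hom.hom (g.comm (n + 1) n)) z.2))

end Subcomplex

end HomologicalAlgebra

/-! ### Chains subordinate to an open cover -/

noncomputable section SmallChains

open AffineChain ConcreteChains

variable {R : Type v} [Ring R] (M : ModuleCat.{u} R)
variable {X : Type u} [TopologicalSpace X] {κ : Type} [Fintype κ]

theorem apply_mem_of_mem_supported {A : Type*} {B : Type*} [AddCommGroup B] [Module R B]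
    {s : Set A} {S : Submodule R B} (f : (A →₀ M) →ₗ[R] B)
    (hf : ∀ a ∈ s, ∀ m : M, f (Finsupp.single a m) ∈ S) {z : A →₀ M}
    (hz : z ∈ Finsupp.supported M R s) : f z ∈ S := by
  rw [← Finsupp.sum_single z, map_finsuppSum]
  exact S.sum_mem fun a ha => hf a (hz ha) _

theorem realize_mem_supported {k : ℕ} {τ : C(stdSimplex ℝ κ, X)}
    {s : Set (Fin k → stdSimplex ℝ κ)} {t : Set C(Simplex k, X)}
    (h : ∀ w ∈ s, τ.comp (affineSimplex w) ∈ t) {c : AffineChain k κ}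
    (hc : c ∈ Finsupp.supported ℤ ℤ s) (m : M) : realize R M τ c m ∈ Finsupp.supported M R t := by
  have : realize R M τ c m = c.sum fun w a => a • Finsupp.single (τ.comp (affineSimplex w)) m := by
    simp only [realize, lift, Finsupp.liftAddHom_apply, Finsupp.sum]
    simp [LinearMap.sum_apply]
  rw [this]
  exact Submodule.sum_mem _ fun w hw => zsmul_mem (Finsupp.single_mem_supported _ _ (h w (hc hw))) _

/-- The singular simplices contained in a subset. -/
def simplicesIn (U : Set X) (n : ℕ) : Set C(Simplex n, X) := {σ | ∀ t, σ t ∈ U}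

/-- The singular chains of `X` whose simplices are each contained in `U` or in `V`. -/
def smallChains (U V : Set X) (n : ℕ) : Submodule R (C(Simplex n, X) →₀ M) :=
  Finsupp.supported M R (simplicesIn U n ∪ simplicesIn V n)

variable {U V : Set X}

theorem realize_mem_smallChains {k : ℕ} {τ : C(stdSimplex ℝ κ, X)}
    (h : (∀ t, τ t ∈ U) ∨ ∀ t, τ t ∈ V) (c : AffineChain k κ) (m : M) :
    realize R M τ c m ∈ smallChains M U V k :=
  realize_mem_supported (s := Set.univ) M
    (fun _ _ => h.imp (fun h _ => h _) (fun h _ => h _)) (fun _ _ => trivial) m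

theorem boundary_mem_smallChains (n : ℕ) (z) (hz : z ∈ smallChains M U V (n + 1)) :
    boundary R M n z ∈ smallChains M U V n :=
  apply_mem_of_mem_supported M _ (fun σ hσ m => by
    rw [← realize_vertex R, boundary_realize]
    exact realize_mem_smallChains M hσ _ _) hz

theorem subdivision_mem_smallChains (n : ℕ) (z) (hz : z ∈ smallChains M U V n) :
    subdivision R M n z ∈ smallChains M U V n :=
  apply_mem_of_mem_supported M _ (fun σ hσ m => by
    rw [subdivision_single]
    exact realize_mem_smallChains M hσ _ _) hz

theorem prismOperator_refl_mem_smallChains (n : ℕ) (z) (hz : z ∈ smallChains M U V n) :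
    prismOperator R M (ContinuousMap.Homotopy.refl (ContinuousMap.id X)) n z ∈
      smallChains M U V (n + 1) :=
  apply_mem_of_mem_supported M _ (fun σ hσ m => by
    rw [prismOperator_single]
    exact realize_mem_smallChains M (hσ.imp (fun h _ => h _) (fun h _ => h _)) _ _) hz

/-- By the Lebesgue number lemma, iterated subdivision makes every singular chain small. -/
theorem exists_iterate_subdivision_mem (hU : IsOpen U) (hV : IsOpen V) (hUV : U ∪ V = Set.univ)
    {n : ℕ} (z : C(Simplex n, X) →₀ M) :
    ∃ j : ℕ, (subdivision R M n)^[j] z ∈ smallChains M U V n := by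
  -- A sum needs as many subdivisions as the worse of its terms, and more of them do no harm.
  have mono : ∀ (z : C(Simplex n, X) →₀ M) (i j : ℕ), i ≤ j →
      (subdivision R M n)^[i] z ∈ smallChains M U V n →
      (subdivision R M n)^[j] z ∈ smallChains M U V n := by
    intro z i j hij h
    induction hij with
    | refl => exact h
    | step _ ih =>
      rw [Function.iterate_succ_apply']
      exact subdivision_mem_smallChains M _ _ ih
  induction z using Finsupp.induction_linear with
  | zero => exact ⟨0, Submodule.zero_mem _⟩
  | add a b ha hb =>
    obtain ⟨i, hi⟩ := ha
    obtain ⟨j, hj⟩ := hb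
    refine ⟨max i j, ?_⟩
    rw [iterate_map_add]
    exact Submodule.add_mem _ (mono _ _ _ (le_max_left _ _) hi) (mono _ _ _ (le_max_right _ _) hj)
  | single σ m =>
    obtain ⟨δ, hδ, hball⟩ := lebesgue_number_lemma_of_metric
      (c := fun b : Bool => σ ⁻¹' (if b then U else V)) (isCompact_univ)
      (fun b => by cases b <;> simpa using IsOpen.preimage σ.continuous (by assumption))
      (fun t _ => by
        rcases hUV.symm.subset (Set.mem_univ (σ t)) with h | h
        · exact Set.mem_iUnion.2 ⟨true, h⟩
        · exact Set.mem_iUnion.2 ⟨false, h⟩)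
    obtain ⟨j, hj⟩ := exists_iterate_subdiv_mem_small n (Fin n) (half_pos hδ)
      (Finsupp.single stdSimplex.vertex 1)
    refine ⟨j, ?_⟩
    rw [← realize_vertex R, iterate_subdivision_realize]
    refine realize_mem_supported M (fun w hw => ?_) hj m
    cases n with
    | zero => exact Or.inl fun t => ((stdSimplex_of_isEmpty_index ℝ (Fin 0)).subset t.2).elim
    | succ n =>
      -- A simplex of diameter less than `δ` lies in the ball of radius `δ` about its first vertex.
      obtain ⟨b, hb⟩ := hball (w 0) trivial
      have key : ∀ t, σ (convexComb w t) ∈ (if b then U else V) := fun t => hb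
        (Metric.mem_ball.2 ((dist_convexComb_le (fun i => hw i 0) t).trans_lt (half_lt_self hδ)))
      cases b
      · exact Or.inr key
      · exact Or.inl key

/-- A chain with small boundary becomes small after adding a boundary, provided that one of its
iterated subdivisions is small. -/
theorem exists_sub_boundary_mem {n : ℕ} (j : ℕ) (z : C(Simplex (n + 1), X) →₀ M)
    (hz : boundary R M n z ∈ smallChains M U V n)
    (hj : (subdivision R M (n + 1))^[j] z ∈ smallChains M U V (n + 1)) :
    ∃ y, z - boundary R M (n + 1) y ∈ smallChains M U V (n + 1) := by
  induction j generalizing z with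
  | zero => exact ⟨0, by simpa using hj⟩
  | succ j ih =>
    obtain ⟨y, hy⟩ := ih (subdivision R M (n + 1) z)
      (by rw [boundary_subdivision]; exact subdivision_mem_smallChains M _ _ hz) hj
    -- The prism of the constant homotopy replaces `z` by its subdivision, up to a boundary and the
    -- small prism on the boundary of `z`.
    have h := boundary_prismOperator_succ R (ContinuousMap.Homotopy.refl (ContinuousMap.id X)) z
    have hid : Finsupp.lmapDomain M R
        ((ContinuousMap.id X).comp : C(Simplex (n + 1), X) → C(Simplex (n + 1), X)) =
        LinearMap.id := LinearMap.ext fun z => Finsupp.mapDomain_id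
    rw [hid, LinearMap.id_apply, LinearMap.id_apply] at h
    refine ⟨y - prismOperator R M (ContinuousMap.Homotopy.refl (ContinuousMap.id X)) (n + 1) z, ?_⟩
    have e : z - boundary R M (n + 1) (y -
        prismOperator R M (ContinuousMap.Homotopy.refl (ContinuousMap.id X)) (n + 1) z) =
        (subdivision R M (n + 1) z - boundary R M (n + 1) y) -
        prismOperator R M (ContinuousMap.Homotopy.refl (ContinuousMap.id X)) n
          (boundary R M n z) := by
      rw [map_sub, h]; abel
    rw [e]
    exact Submodule.sub_mem _ hy (prismOperator_refl_mem_smallChains M _ _ hz)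

theorem concreteChains_d_mem_smallChains (n : ℕ) (z : (concreteChains M X).X (n + 1))
    (hz : z ∈ smallChains M U V (n + 1)) :
    (concreteChains M X).d (n + 1) n z ∈ smallChains M U V n := by
  rw [concreteChains_d]
  exact boundary_mem_smallChains M n z hz

variable (U V) in
/-- The complex of singular chains that are small with respect to `U` and `V`. -/
def smallComplex : ChainComplex (ModuleCat.{u} R) ℕ :=
  subcomplex (concreteChains M X) (smallChains M U V) (concreteChains_d_mem_smallChains M)

variable (U V) in
/-- The inclusion of the small chains. -/
def smallι : smallComplex M U V ⟶ concreteChains M X :=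
  subcomplexι (concreteChains M X) (smallChains M U V) (concreteChains_d_mem_smallChains M)

/-- The theorem of small chains. -/
theorem isIso_homologyMap_smallι (hU : IsOpen U) (hV : IsOpen V) (hUV : U ∪ V = Set.univ) (n : ℕ) :
    IsIso (HomologicalComplex.homologyMap (smallι M U V) n) := by
  refine isIso_homologyMap_subcomplexι _ _ _ (fun z => ⟨0, ?_⟩) (fun n z hz => ?_) n
  · rw [map_zero, sub_zero]
    exact fun σ _ => Or.inl fun t => ((stdSimplex_of_isEmpty_index ℝ (Fin 0)).subset t.2).elim
  · rw [concreteChains_d] at hz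
    rw [concreteChains_d]
    obtain ⟨j, hj⟩ := exists_iterate_subdivision_mem (n := n + 1) M hU hV hUV z
    exact exists_sub_boundary_mem M j z hz hj

/-! ### The Mayer–Vietoris sequence -/

/-- The inclusion of a subset, as a continuous map. -/
def inclC (U : Set X) : C(U, X) := ⟨Subtype.val, continuous_subtype_val⟩

/-- The inclusion of a subset into a larger one, as a continuous map. -/
def inclC₂ {U W : Set X} (h : U ⊆ W) : C(U, W) := ⟨Set.inclusion h, continuous_inclusion h⟩

theorem inclC_comp_injective (U : Set X) (n : ℕ) :
    Function.Injective (fun σ : C(Simplex n, U) => (inclC U).comp σ) := fun _ _ h =>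
  ContinuousMap.ext fun t => Subtype.ext (DFunLike.congr_fun h t)

theorem concreteMap_inclC_injective (U : Set X) (n : ℕ) :
    Function.Injective ((concreteMap M (inclC U)).f n) :=
  Finsupp.mapDomain_injective (inclC_comp_injective U n)

theorem mem_supported_simplicesIn_iff (U : Set X) (n : ℕ) (z : C(Simplex n, X) →₀ M) :
    z ∈ Finsupp.supported M R (simplicesIn U n) ↔
      ∃ y, Finsupp.lmapDomain M R (inclC U).comp y = z := by
  have h : simplicesIn U n = (fun σ : C(Simplex n, U) => (inclC U).comp σ) '' Set.univ := by
    ext σ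
    constructor
    · exact fun h => ⟨⟨fun t => ⟨σ t, h t⟩, by fun_prop⟩, trivial, rfl⟩
    · rintro ⟨σ, -, rfl⟩ t
      exact (σ t).2
  rw [h, ← Finsupp.lmapDomain_supported, Finsupp.supported_univ]
  simp

/-- The map induced by the inclusion of a subset that is contained in one of the two members of the
cover takes values in the small chains. -/
def toSmallLinear {W : Set X} (n : ℕ) (h : simplicesIn W n ⊆ simplicesIn U n ∪ simplicesIn V n) :
    (C(Simplex n, W) →₀ M) →ₗ[R] smallChains M U V n :=
  (Finsupp.lmapDomain M R (inclC W).comp).codRestrict (smallChains M U V n) fun y =>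
      Finsupp.supported_mono h ((mem_supported_simplicesIn_iff M W n _).2 ⟨y, rfl⟩)

/-- The chain map to the small chains induced by the inclusion of a subset that is contained in one
of the two members of the cover. -/
def toSmall {W : Set X} (h : ∀ n, simplicesIn W n ⊆ simplicesIn U n ∪ simplicesIn V n) :
    concreteChains M W ⟶ smallComplex M U V :=
  ChainComplex.ofHom (fun n => (ModuleCat.ofHom (toSmallLinear M n (h n)) :
      ModuleCat.of R (C(Simplex n, W) →₀ M) ⟶ ModuleCat.of R (smallChains M U V n)))
    fun n => by
      refine Eq.trans (congrArg _ (subcomplex_d _ _ (concreteChains_d_mem_smallChains M) n)) ?_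
      refine Eq.trans ?_ (congrArg (· ≫ _) (concreteChains_d M n).symm)
      refine ModuleCat.hom_ext (LinearMap.ext fun z => Subtype.ext ?_)
      refine Eq.trans ?_ (boundary_mapDomain R (inclC W) z)
      exact LinearMap.congr_fun (congrArg ModuleCat.Hom.hom (concreteChains_d M n)) _

/-- The Mayer–Vietoris sequence of a cover of `X` by open subsets `U` and `V` with `V` acyclic and
the inclusion of `U` split on homology. The exact sequence of chain complexes
`0 → C(U ∩ V) → C(U) × C(V) → C(U) + C(V) → 0` has the small chains as its last term. -/
theorem nonempty_homology_equiv_of_cover (hU : IsOpen U) (hV : IsOpen V)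
    (hUV : U ∪ V = Set.univ) (hac : (concreteChains M V).Acyclic)
    (hsp : ∀ n, IsSplitMono (HomologicalComplex.homologyMap (concreteMap M (inclC U)) n)) (n : ℕ) :
    Nonempty ((concreteChains M X).homology (n + 1) ≃ₗ[R]
      (concreteChains M U).homology (n + 1) ×
        (concreteChains M (U ∩ V : Set X)).homology n) := by
  let jU : concreteChains M U ⟶ smallComplex M U V := toSmall M fun n => Set.subset_union_left
  let jV : concreteChains M V ⟶ smallComplex M U V := toSmall M fun n => Set.subset_union_right
  let f : concreteChains M (U ∩ V : Set X) ⟶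
      prodComplex (concreteChains M U) (concreteChains M V) :=
    prodLift (concreteMap M (inclC₂ Set.inter_subset_left))
      (concreteMap M (inclC₂ Set.inter_subset_right))
  let g : prodComplex (concreteChains M U) (concreteChains M V) ⟶ smallComplex M U V :=
    prodDesc jU (-jV)
  have hg : ∀ n (z : (C(Simplex n, U) →₀ M) × (C(Simplex n, V) →₀ M)),
      (g.f n z : smallChains M U V n).1 = Finsupp.lmapDomain M R (inclC U).comp z.1 -
        Finsupp.lmapDomain M R (inclC V).comp z.2 := fun n z =>
    (sub_eq_add_neg _ _).symm
  have hcU : ∀ n (y : C(Simplex n, (U ∩ V : Set X)) →₀ M), Finsupp.lmapDomain M R (inclC U).comp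
      (Finsupp.lmapDomain M R (inclC₂ Set.inter_subset_left).comp y) =
        Finsupp.lmapDomain M R (inclC (U ∩ V)).comp y := fun n y =>
    (Finsupp.mapDomain_comp (f := (inclC₂ (Set.inter_subset_left (s := U) (t := V))).comp)
      (g := (inclC U).comp)).symm
  have hcV : ∀ n (y : C(Simplex n, (U ∩ V : Set X)) →₀ M), Finsupp.lmapDomain M R (inclC V).comp
      (Finsupp.lmapDomain M R (inclC₂ Set.inter_subset_right).comp y) =
        Finsupp.lmapDomain M R (inclC (U ∩ V)).comp y := fun n y =>
    (Finsupp.mapDomain_comp (f := (inclC₂ (Set.inter_subset_right (s := U) (t := V))).comp)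
      (g := (inclC V).comp)).symm
  have w : f ≫ g = 0 := by
    ext n : 1
    refine ModuleCat.hom_ext (LinearMap.ext fun y => Subtype.ext ((hg n _).trans ?_))
    exact sub_eq_zero.2 ((hcU n y).trans (hcV n y).symm)
  have hS : (ShortComplex.mk _ _ w).ShortExact := by
    refine shortExact_of_exact_apply (fun n y y' h => ?_) (fun n z => ?_) (fun n z hz => ?_)
    · refine concreteMap_inclC_injective M (U ∩ V) n ?_
      refine (hcU n y).symm.trans (Eq.trans ?_ (hcU n y'))
      exact congrArg _ (congrArg Prod.fst h)
    · obtain ⟨z, hz⟩ : smallChains M U V n := z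
      rw [smallChains, Finsupp.supported_union] at hz
      obtain ⟨a, ha, b, hb, rfl⟩ := Submodule.mem_sup.1 hz
      obtain ⟨a, rfl⟩ := (mem_supported_simplicesIn_iff M U n a).1 ha
      obtain ⟨b, rfl⟩ := (mem_supported_simplicesIn_iff M V n b).1 hb
      refine ⟨(a, -b), Subtype.ext ((hg n _).trans ?_)⟩
      rw [map_neg, sub_neg_eq_add]
    · have h0 := sub_eq_zero.1 ((hg n z).symm.trans (congrArg Subtype.val hz))
      obtain ⟨a, b⟩ : (C(Simplex n, U) →₀ M) × (C(Simplex n, V) →₀ M) := z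
      have hmem : Finsupp.lmapDomain M R (inclC U).comp a ∈
          Finsupp.supported M R (simplicesIn (U ∩ V) n) := by
        have : simplicesIn (U ∩ V) n = simplicesIn U n ∩ simplicesIn V n := by
          ext σ; exact forall_and
        rw [this, Finsupp.supported_inter]
        exact ⟨(mem_supported_simplicesIn_iff M U n _).2 ⟨_, rfl⟩,
          (mem_supported_simplicesIn_iff M V n _).2 ⟨_, h0.symm⟩⟩
      obtain ⟨y, hy⟩ := (mem_supported_simplicesIn_iff M _ n _).1 hmem
      refine ⟨y, Prod.ext (concreteMap_inclC_injective M U n ?_)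
        (concreteMap_inclC_injective M V n ?_)⟩
      · exact (hcU n y).trans hy
      · exact (hcV n y).trans (hy.trans h0)
  -- The factor `V` being acyclic, `g` is on homology the inclusion of `U`, up to isomorphisms.
  have hi : prodInl (concreteChains M U) (concreteChains M V) ≫ g ≫ smallι M U V =
      concreteMap M (inclC U) := by
    ext n : 1
    refine ModuleCat.hom_ext (LinearMap.ext fun y => (hg n (y, 0)).trans ?_)
    exact (congrArg _ (map_zero _)).trans (sub_zero _)
  have iso1 := isIso_homologyMap_prodInl (concreteChains M U) (concreteChains M V) hac
  have iso2 := isIso_homologyMap_smallι M hU hV hUV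
  have hsplit : ∀ n, IsSplitMono (HomologicalComplex.homologyMap g n) := fun n => by
    have := iso1 n
    have := iso2 n
    have := hsp n
    have e : HomologicalComplex.homologyMap g n =
        inv (HomologicalComplex.homologyMap (prodInl (concreteChains M U) (concreteChains M V)) n) ≫
          HomologicalComplex.homologyMap (concreteMap M (inclC U)) n ≫
            inv (HomologicalComplex.homologyMap (smallι M U V) n) := by
      rw [← hi, HomologicalComplex.homologyMap_comp, HomologicalComplex.homologyMap_comp]
      simp
    rw [e]
    infer_instance
  obtain ⟨e⟩ := nonempty_homology_equiv_prod hS hsplit n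
  have := iso1 (n + 1)
  have := iso2 (n + 1)
  exact ⟨(asIso (HomologicalComplex.homologyMap (smallι M U V) (n + 1))).toLinearEquiv.symm.trans
    (e.trans ((asIso (HomologicalComplex.homologyMap
      (prodInl (concreteChains M U) (concreteChains M V)) (n + 1))).toLinearEquiv.symm.prodCongr
        (LinearEquiv.refl R _)))⟩

end SmallChains

/-! ### Comparison with the singular simplicial set -/

noncomputable section Comparison

open ConcreteChains

variable {R : Type v} [Ring R] (M : ModuleCat.{u} R) (X : TopCat.{u})

/-- Singular simplices in the sense of the singular simplicial set, as continuous maps. -/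
def singularSimplexEquiv (n : ℕ) :
    (TopCat.toSSet.obj X).obj (Opposite.op (SimplexCategory.mk n)) ≃ C(Simplex (n + 1), X) :=
  X.toSSetObjEquiv (Opposite.op (SimplexCategory.mk n))

theorem map_succAbove_eq_convexComb {n : ℕ} (i : Fin (n + 1)) (t : Simplex n) :
    stdSimplex.map i.succAbove t = convexComb (faceVertices i) t := by
  ext a
  rw [convexComb_apply, stdSimplex.map_coe, FunOnFinite.linearMap_apply_apply]
  simp only [faceVertices, stdSimplex.vertex_coe, Pi.single_apply, mul_ite, mul_one, mul_zero]
  rw [Finset.sum_filter]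
  exact Finset.sum_congr rfl fun j _ => by simp only [eq_comm]

theorem singularSimplexEquiv_δ {n : ℕ} (i : Fin (n + 2))
    (x : (TopCat.toSSet.obj X).obj (Opposite.op (SimplexCategory.mk (n + 1)))) :
    singularSimplexEquiv X n ((TopCat.toSSet.obj X).δ i x) =
      (singularSimplexEquiv X (n + 1) x).comp (faceMap i) := by
  ext t : 1
  refine Eq.trans ?_ (congrArg (singularSimplexEquiv X (n + 1) x)
    (map_succAbove_eq_convexComb i t))
  rfl

/-- The map from singular chains to finitely supported functions on singular simplices. -/
def ofSingularChains (n : ℕ) :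
    (singularChains M X).X n ⟶ ModuleCat.of R (C(Simplex (n + 1), X) →₀ M) :=
  ((TopCat.toSSet.obj X).isColimitChainComplexXCofan M n).desc
    (Limits.Cofan.mk _ fun x => ModuleCat.ofHom (Finsupp.lsingle (singularSimplexEquiv X n x)))

theorem ι_ofSingularChains (n : ℕ)
    (x : (TopCat.toSSet.obj X).obj (Opposite.op (SimplexCategory.mk n))) :
    (TopCat.toSSet.obj X).ιChainComplex x ≫ ofSingularChains M X n =
      ModuleCat.ofHom (Finsupp.lsingle (singularSimplexEquiv X n x)) :=
  ((TopCat.toSSet.obj X).isColimitChainComplexXCofan M n).fac _ ⟨x⟩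

/-- The map to singular chains from finitely supported functions on singular simplices. -/
def toSingularChains (n : ℕ) :
    (C(Simplex (n + 1), X) →₀ M) →ₗ[R] (singularChains M X).X n :=
  Finsupp.lsum ℕ fun σ => ModuleCat.Hom.hom ((TopCat.toSSet.obj X).ιChainComplex (R := M)
    ((singularSimplexEquiv X n).symm σ))

theorem toSingularChains_single (n : ℕ) (σ : C(Simplex (n + 1), X)) (m : M) :
    toSingularChains M X n (Finsupp.single σ m) =
      (TopCat.toSSet.obj X).ιChainComplex (R := M) ((singularSimplexEquiv X n).symm σ) m := by
  simp [toSingularChains]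

/-- Singular chains as finitely supported functions on singular simplices. -/
def singularChainsIso (n : ℕ) :
    (singularChains M X).X n ≅ ModuleCat.of R (C(Simplex (n + 1), X) →₀ M) where
  hom := ofSingularChains M X n
  inv := ModuleCat.ofHom (toSingularChains M X n)
  hom_inv_id := by
    apply SSet.chainComplex_hom_ext
    intro x
    refine ModuleCat.hom_ext (LinearMap.ext fun m => ?_)
    refine (congrArg (toSingularChains M X n) (LinearMap.congr_fun (congrArg ModuleCat.Hom.hom
      (ι_ofSingularChains M X n x)) m)).trans ?_
    refine (toSingularChains_single M X n _ m).trans ?_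
    rw [Equiv.symm_apply_apply]
    rfl
  inv_hom_id := by
    refine ModuleCat.hom_ext (Finsupp.lhom_ext fun σ m => ?_)
    refine (congrArg (ofSingularChains M X n) (toSingularChains_single M X n σ m)).trans ?_
    refine (LinearMap.congr_fun (congrArg ModuleCat.Hom.hom (ι_ofSingularChains M X n _)) m).trans
      ?_
    rw [Equiv.apply_symm_apply]
    rfl

theorem ofSingularChains_boundary (n : ℕ) :
    ofSingularChains M X (n + 1) ≫ ModuleCat.ofHom (boundary R M (n + 1)) =
      (singularChains M X).d (n + 1) n ≫ ofSingularChains M X n := by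
  apply SSet.chainComplex_hom_ext
  intro x
  rw [← Category.assoc, ι_ofSingularChains, SSet.ιChainComplex_d_assoc, Preadditive.sum_comp]
  simp only [Preadditive.zsmul_comp, ι_ofSingularChains, singularSimplexEquiv_δ]
  refine ModuleCat.hom_ext (LinearMap.ext fun m => ?_)
  refine (boundary_single R _ m).trans ?_
  simp

instance : Subsingleton C(Simplex 0, X) where
  allEq _ _ := ContinuousMap.ext fun t =>
    ((stdSimplex_of_isEmpty_index ℝ (Fin 0)).subset t.2).elim

/-- The unique map from the empty simplex. -/
def emptySimplex : C(Simplex 0, X) where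
  toFun t := ((stdSimplex_of_isEmpty_index ℝ (Fin 0)).subset t.2).elim
  continuous_toFun := continuous_iff_continuousAt.2 fun t =>
    ((stdSimplex_of_isEmpty_index ℝ (Fin 0)).subset t.2).elim

/-- The coefficient module, in degree `-1` of the augmented complex, as the chains on the unique
map from the empty simplex. -/
def augmentationIso : M ≅ ModuleCat.of R (C(Simplex 0, X) →₀ M) :=
  (Finsupp.uniqueLinearEquiv R M (emptySimplex X)).symm.toModuleIso

theorem ofSingularChains_boundary_zero :
    ofSingularChains M X 0 ≫ ModuleCat.ofHom (boundary R M 0) =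
      singularAugmentation M X ≫ (augmentationIso M X).hom := by
  apply SSet.chainComplex_hom_ext
  intro x
  rw [← Category.assoc, ι_ofSingularChains, ← Category.assoc, ι_singularAugmentation,
    Category.id_comp]
  refine ModuleCat.hom_ext (LinearMap.ext fun m => ?_)
  refine (boundary_single R _ m).trans ?_
  rw [Fin.sum_univ_succ, Fin.sum_univ_zero, add_zero, Fin.val_zero, pow_zero, one_smul]
  refine Finsupp.ext fun σ => ?_
  refine Eq.trans ?_ (Finsupp.uniqueLinearEquiv_symm_apply_apply R M (emptySimplex X) m σ).symm
  rw [Subsingleton.elim σ ((singularSimplexEquiv X 0 x).comp (faceMap 0)), Finsupp.single_eq_same]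

/-- The augmented singular chain complex as a complex of finitely supported functions. -/
def augmentedSingularChainsIso : augmentedSingularChains M X ≅ concreteChains M X :=
  HomologicalComplex.Hom.isoOfComponents
    (fun n => match n with
      | 0 => augmentationIso M X
      | n + 1 => singularChainsIso M X n)
    fun i j hij => by
      obtain rfl : j + 1 = i := hij
      rw [concreteChains_d]
      cases j with
      | zero => exact ofSingularChains_boundary_zero M X
      | succ n => exact ofSingularChains_boundary M X n

/-- Reduced homology in degree `n` is the homology of the concrete complex in degree `n + 1`. -/
def reducedHomologyEquiv (n : ℕ) :
    reducedHomology M X n ≃ₗ[R] (concreteChains M X).homology (n + 1) :=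
  ((HomologicalComplex.homologyFunctor _ _ (n + 1)).mapIso
    (augmentedSingularChainsIso M X)).toLinearEquiv

/-- Reduced homology in degree `n - 1` is the homology of the concrete complex in degree `n`. -/
def reducedHomologySubOneEquiv (n : ℕ) :
    reducedHomology M X (n - 1) ≃ₗ[R] (concreteChains M X).homology n :=
  match n with
  | 0 => ((HomologicalComplex.homologyFunctor _ _ 0).mapIso
    (augmentedSingularChainsIso M X)).toLinearEquiv
  | n + 1 => (LinearEquiv.cast (R := R) (M := fun k => reducedHomology M X k)
    (by push_cast; ring)).trans (reducedHomologyEquiv M X n)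

end Comparison

/-! ### The geometry of cones with several apexes -/

noncomputable section Geometry

variable {V : Type u} (F : PreAbstractSimplicialComplex V) {q : ℕ}

/-- Maps into a subspace of a space of functions are homotopic if the straight line segments
joining their values are contained in the subspace. -/
theorem homotopic_of_segment {W Y A : Type*} [TopologicalSpace Y] [TopologicalSpace A]
    {i : A → W → ℝ} (hi : Topology.IsEmbedding i) (f g : C(Y, A))
    (h : ∀ y, ∀ t ∈ Set.Icc (0 : ℝ) 1, ∃ a, i a = fun w => (1 - t) * i (f y) w + t * i (g y) w) :
    f.Homotopic g := by
  choose H hH using h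
  have hc : Continuous fun p : unitInterval × Y => H p.2 p.1 p.1.2 := by
    rw [hi.continuous_iff]
    have e : (i ∘ fun p : unitInterval × Y => H p.2 p.1 p.1.2) = fun p w =>
        (1 - (p.1 : ℝ)) * i (f p.2) w + (p.1 : ℝ) * i (g p.2) w := funext fun p => hH _ _ _
    rw [e]
    refine continuous_pi fun w => ?_
    have hf : Continuous fun p : unitInterval × Y => i (f p.2) w :=
      (continuous_apply w).comp (hi.continuous.comp (f.continuous.comp continuous_snd))
    have hg : Continuous fun p : unitInterval × Y => i (g p.2) w :=
      (continuous_apply w).comp (hi.continuous.comp (g.continuous.comp continuous_snd))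
    have ht : Continuous fun p : unitInterval × Y => (p.1 : ℝ) :=
      continuous_subtype_val.comp continuous_fst
    exact ((continuous_const.sub ht).mul hf).add (ht.mul hg)
  refine ⟨⟨⟨fun p => H p.2 p.1 p.1.2, hc⟩, fun y => hi.injective ?_, fun y => hi.injective ?_⟩⟩
  · refine (hH y _ _).trans (funext fun w => ?_)
    simp
  · refine (hH y _ _).trans (funext fun w => ?_)
    simp

/-- The points of the simplex spanned by the vertices in `σ` and the `i`-th apex, in barycentric
coordinates. The set `σ` may be empty. -/
structure MemConeFace (σ : Finset V) (i : Fin q) (x : V ⊕ Fin q → ℝ) : Prop where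
  nonneg : ∀ w, 0 ≤ x w
  left : ∀ v ∉ σ, x (Sum.inl v) = 0
  right : ∀ j ≠ i, x (Sum.inr j) = 0
  sum : ∑ v ∈ σ, x (Sum.inl v) + x (Sum.inr i) = 1

theorem MemConeFace.segment {σ : Finset V} {i : Fin q} {x y : V ⊕ Fin q → ℝ}
    (hx : MemConeFace σ i x) (hy : MemConeFace σ i y) {t : ℝ} (ht : t ∈ Set.Icc (0 : ℝ) 1) :
    MemConeFace σ i fun w => (1 - t) * x w + t * y w where
  nonneg w := add_nonneg (mul_nonneg (sub_nonneg.2 ht.2) (hx.nonneg w))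
    (mul_nonneg ht.1 (hy.nonneg w))
  left v hv := by rw [hx.left v hv, hy.left v hv]; ring
  right j hj := by rw [hx.right j hj, hy.right j hj]; ring
  sum := by
    rw [Finset.sum_add_distrib, ← Finset.mul_sum, ← Finset.mul_sum]
    linear_combination (1 - t) * hx.sum + t * hy.sum

variable {F} in
/-- Every point of the `q`-cone lies in a simplex that contains an apex, where `i₀` serves for the
points of `F`. -/
theorem mem_realizationSet_qCone_iff (i₀ : Fin q) (x : V ⊕ Fin q → ℝ) :
    x ∈ realizationSet (qCone F q) ↔
      ∃ σ, (σ ∈ F.faces ∨ σ = ∅) ∧ ∃ i, MemConeFace σ i x := by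
  constructor
  · rintro ⟨h0, s, ⟨-, σ, τ, hσ, hτ, rfl⟩, hs, hsum⟩
    rw [Finset.sum_disjSum] at hsum
    have hl : ∀ v ∉ σ, x (Sum.inl v) = 0 := fun v hv => hs _ (by simpa using hv)
    have hr : ∀ j ∉ τ, x (Sum.inr j) = 0 := fun v hv => hs _ (by simpa using hv)
    refine ⟨σ, hσ, ?_⟩
    rcases hτ with ⟨i, rfl⟩ | rfl
    · exact ⟨i, h0, hl, fun j hj => hr j (by simpa using hj), by simpa using hsum⟩
    · exact ⟨i₀, h0, hl, fun j _ => hr j (by simp), by simpa [hr i₀] using hsum⟩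
  · rintro ⟨σ, hσ, i, hx⟩
    refine ⟨hx.nonneg, σ.disjSum {i}, ⟨⟨Sum.inr i, by simp⟩, σ, {i}, hσ, Or.inl ⟨i, rfl⟩, rfl⟩,
      ?_, ?_⟩
    · rintro (v | j) h
      · exact hx.left v (by simpa using h)
      · exact hx.right j (by simpa using h)
    · rw [Finset.sum_disjSum]
      simpa using hx.sum

variable (q) in
/-- The part of the `q`-cone on `F` with the first `k` apexes only, a copy of the `k`-cone. Keeping
all `q` apex coordinates makes the cones for varying `k` subsets of one another. -/
def partialCone (k : ℕ) : Set (V ⊕ Fin q → ℝ) :=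
  {x | (∃ σ, (σ ∈ F.faces ∨ σ = ∅) ∧ ∃ i, MemConeFace σ i x) ∧
    ∀ j : Fin q, k ≤ j → x (Sum.inr j) = 0}

/-- The `p`-th apex. -/
def apex (V : Type u) (p : Fin q) : V ⊕ Fin q → ℝ := Sum.elim 0 (Pi.single p 1)

theorem memConeFace_apex (σ : Finset V) (p : Fin q) : MemConeFace σ p (apex V p) where
  nonneg w := by
    rcases w with v | j
    · exact le_rfl
    · by_cases h : j = p
      · subst h; simp [apex]
      · simp [apex, h]
  left v _ := rfl
  right j hj := by simp [apex, hj]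
  sum := by simp [apex]

theorem apex_mem_partialCone {k : ℕ} {p : Fin q} (hp : (p : ℕ) < k) :
    apex V p ∈ partialCone F q k :=
  ⟨⟨∅, Or.inr rfl, p, memConeFace_apex ∅ p⟩, fun j hj => by
    have : j ≠ p := by rintro rfl; omega
    simp [apex, this]⟩

variable {F}

theorem segment_mem_partialCone {k : ℕ} {σ : Finset V} (hσ : σ ∈ F.faces ∨ σ = ∅) {i : Fin q}
    {x y : V ⊕ Fin q → ℝ} (hx : MemConeFace σ i x) (hy : MemConeFace σ i y)
    (hx' : ∀ j : Fin q, k ≤ j → x (Sum.inr j) = 0) (hy' : ∀ j : Fin q, k ≤ j → y (Sum.inr j) = 0)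
    {t : ℝ} (ht : t ∈ Set.Icc (0 : ℝ) 1) :
    (fun w => (1 - t) * x w + t * y w) ∈ partialCone F q k :=
  ⟨⟨σ, hσ, i, hx.segment hy ht⟩, fun j hj => by
    change (1 - t) * x _ + t * y _ = 0
    rw [hx' j hj, hy' j hj]; ring⟩

theorem MemConeFace.eq_of_pos {σ : Finset V} {i p : Fin q} {x : V ⊕ Fin q → ℝ}
    (hx : MemConeFace σ i x) (hp : 0 < x (Sum.inr p)) : i = p := by
  by_contra h
  exact hp.ne' (hx.right p (Ne.symm h))

/-- A cone with a single apex is contractible. -/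
theorem partialCone_one_homotopic (hq : 0 < q) :
    (ContinuousMap.id (partialCone F q 1)).Homotopic
      (.const _ ⟨apex V ⟨0, hq⟩, apex_mem_partialCone F (by simp)⟩) := by
  refine homotopic_of_segment Topology.IsEmbedding.subtypeVal _ _ fun x t ht => ?_
  obtain ⟨x, ⟨σ, hσ, i, hx⟩, hx'⟩ := x
  have h0 : MemConeFace σ ⟨0, hq⟩ x := by
    by_cases hi : i = ⟨0, hq⟩
    · exact hi ▸ hx
    · have h1 : x (Sum.inr i) = 0 := hx' i (by
        have : (i : ℕ) ≠ 0 := fun h => hi (Fin.ext h)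
        omega)
      have h2 := hx.right ⟨0, hq⟩ (Ne.symm hi)
      refine ⟨hx.nonneg, hx.left, fun j hj => ?_, ?_⟩
      · by_cases hji : j = i
        · exact hji ▸ h1
        · exact hx.right j hji
      · rw [h2, ← h1, hx.sum]
  exact ⟨⟨_, segment_mem_partialCone hσ h0 (memConeFace_apex σ _) hx'
    (apex_mem_partialCone F (by simp)).2 ht⟩, rfl⟩

variable (F q) in
/-- The inclusion of the `k`-cone into the `(k + 1)`-cone. -/
def coneIncl (k : ℕ) : C(partialCone F q k, partialCone F q (k + 1)) :=
  ⟨fun x => ⟨x.1, x.2.1, fun j hj => x.2.2 j (by omega)⟩, by fun_prop⟩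

section Step

variable {k : ℕ} (hk : k < q)

/-- The open star of the last apex of `partialCone F q (k + 1)`. -/
def openStar (F : PreAbstractSimplicialComplex V) : Set (partialCone F q (k + 1)) :=
  {x | 0 < x.1 (Sum.inr ⟨k, hk⟩)}

/-- The complement of the last apex of `partialCone F q (k + 1)`, the only point at which the
coordinate of that apex is `1`. -/
def apexCompl (F : PreAbstractSimplicialComplex V) : Set (partialCone F q (k + 1)) :=
  {x | x.1 (Sum.inr ⟨k, hk⟩) < 1}

theorem isOpen_openStar : IsOpen (openStar hk F) :=
  isOpen_lt continuous_const ((continuous_apply _).comp continuous_subtype_val)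

theorem isOpen_apexCompl : IsOpen (apexCompl hk F) :=
  isOpen_lt ((continuous_apply _).comp continuous_subtype_val) continuous_const

theorem apexCompl_union_openStar : apexCompl hk F ∪ openStar hk F = Set.univ := by
  refine Set.eq_univ_of_forall fun x => ?_
  rcases lt_or_ge (x.1 (Sum.inr ⟨k, hk⟩)) 1 with h | h
  · exact Or.inl h
  · exact Or.inr (zero_lt_one.trans_le h)

theorem isEmbedding_val_val {W : Type*} {A : Set (W → ℝ)} (B : Set A) :
    Topology.IsEmbedding fun b : B => b.1.1 :=
  Topology.IsEmbedding.subtypeVal.comp Topology.IsEmbedding.subtypeVal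

/-- The last apex as a point of its open star. -/
def starApex (F : PreAbstractSimplicialComplex V) : openStar hk F :=
  ⟨⟨apex V ⟨k, hk⟩, apex_mem_partialCone F (by simp)⟩, by simp [openStar, apex]⟩

theorem openStar_homotopic :
    (ContinuousMap.id (openStar hk F)).Homotopic (.const _ (starApex hk F)) := by
  refine homotopic_of_segment (isEmbedding_val_val _) _ _ fun x t ht => ?_
  obtain ⟨⟨x, ⟨σ, hσ, i, hx⟩, hx'⟩, hpos⟩ := x
  change 0 < x _ at hpos
  obtain rfl := hx.eq_of_pos hpos
  refine ⟨⟨⟨_, segment_mem_partialCone hσ hx (memConeFace_apex σ _) hx'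
    (starApex hk F).1.2.2 ht⟩, ?_⟩, rfl⟩
  change 0 < (1 - t) * x (Sum.inr ⟨k, hk⟩) + t * apex V ⟨k, hk⟩ (Sum.inr ⟨k, hk⟩)
  have : apex V ⟨k, hk⟩ (Sum.inr ⟨k, hk⟩) = 1 := by simp [apex]
  rw [this]
  rcases ht.1.eq_or_lt with rfl | h
  · simpa using hpos
  · have := mul_nonneg (sub_nonneg.2 ht.2) hpos.le
    linarith

theorem coneIncl_mem_apexCompl (x : partialCone F q k) : coneIncl F q k x ∈ apexCompl hk F := by
  change x.1 _ < 1
  rw [x.2.2 ⟨k, hk⟩ le_rfl]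
  exact zero_lt_one

/-- The inclusion of the `k`-cone into the complement of the last apex of the `(k + 1)`-cone. -/
def coneInclCompl (F : PreAbstractSimplicialComplex V) : C(partialCone F q k, apexCompl hk F) :=
  ⟨fun x => ⟨coneIncl F q k x, coneIncl_mem_apexCompl hk x⟩,
    (coneIncl F q k).continuous.subtype_mk _⟩

/-- Removes the coordinate at an apex and rescales, the projection away from that apex. -/
def dropApex (p : Fin q) (x : V ⊕ Fin q → ℝ) : V ⊕ Fin q → ℝ :=
  Sum.elim (fun v => x (Sum.inl v) / (1 - x (Sum.inr p)))
    (fun j => if j = p then 0 else x (Sum.inr j) / (1 - x (Sum.inr p)))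

theorem MemConeFace.dropApex {σ : Finset V} {i p : Fin q} {x : V ⊕ Fin q → ℝ}
    (hx : MemConeFace σ i x) (hp : x (Sum.inr p) < 1) : MemConeFace σ i (dropApex p x) where
  nonneg w := by
    have := hx.nonneg
    have h1 : 0 ≤ 1 - x (Sum.inr p) := (sub_pos.2 hp).le
    rcases w with v | j
    · exact div_nonneg (hx.nonneg _) h1
    · change 0 ≤ ite _ _ _
      split_ifs
      · exact le_rfl
      · exact div_nonneg (hx.nonneg _) h1
  left v hv := by simp [_root_.dropApex, hx.left v hv]
  right j hj := by simp [_root_.dropApex, hx.right j hj]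
  sum := by
    have h1 : 1 - x (Sum.inr p) ≠ 0 := (sub_pos.2 hp).ne'
    have hs := hx.sum
    by_cases hi : i = p
    · subst hi
      simp only [_root_.dropApex, Sum.elim_inl, Sum.elim_inr, if_pos, ← Finset.sum_div]
      rw [add_zero, div_eq_one_iff_eq h1]
      linarith
    · have h0 := hx.right p (Ne.symm hi)
      simp only [_root_.dropApex, Sum.elim_inl, Sum.elim_inr, if_neg hi, h0, sub_zero, div_one]
      exact hs

theorem dropApex_vanish {x : V ⊕ Fin q → ℝ}
    (hx : ∀ j : Fin q, k + 1 ≤ j → x (Sum.inr j) = 0) (j : Fin q) (hj : k ≤ j) :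
    dropApex ⟨k, hk⟩ x (Sum.inr j) = 0 := by
  by_cases h : j = ⟨k, hk⟩
  · simp [dropApex, h]
  · have : (j : ℕ) ≠ k := fun e => h (Fin.ext e)
    simp [dropApex, hx j (by omega)]

/-- The deformation retraction of the complement of the last apex onto the `k`-cone. -/
def coneRetr (F : PreAbstractSimplicialComplex V) : C(apexCompl hk F, partialCone F q k) where
  toFun x := ⟨dropApex ⟨k, hk⟩ x.1.1, by
    obtain ⟨⟨x, ⟨σ, hσ, i, hx⟩, hx'⟩, hlt⟩ := x
    exact ⟨⟨σ, hσ, i, hx.dropApex hlt⟩, dropApex_vanish hk hx'⟩⟩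
  continuous_toFun := by
    refine Continuous.subtype_mk (continuous_pi fun w => ?_) _
    have hc : ∀ w, Continuous fun x : apexCompl hk F => x.1.1 w := fun w =>
      (continuous_apply w).comp (isEmbedding_val_val _).continuous
    have hd : ∀ w, Continuous fun x : apexCompl hk F =>
        x.1.1 w / (1 - x.1.1 (Sum.inr ⟨k, hk⟩)) := fun w =>
      (hc w).div (continuous_const.sub (hc _)) fun x => (sub_pos.2 x.2).ne'
    rcases w with v | j
    · exact hd _
    · by_cases h : j = ⟨k, hk⟩
      · simpa [dropApex, h] using continuous_const
      · simpa [dropApex, h] using hd _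

theorem coneRetr_comp_coneInclCompl :
    (coneRetr hk F).comp (coneInclCompl hk F) = ContinuousMap.id _ := by
  ext x : 1
  refine Subtype.ext (funext fun w => ?_)
  change dropApex ⟨k, hk⟩ x.1 w = x.1 w
  have h0 := x.2.2 ⟨k, hk⟩ le_rfl
  rcases w with v | j
  · simp [dropApex, h0]
  · by_cases h : j = ⟨k, hk⟩
    · subst h; simp [dropApex, h0]
    · simp [dropApex, h0, h]

theorem coneInclCompl_comp_coneRetr :
    ((coneInclCompl hk F).comp (coneRetr hk F)).Homotopic (ContinuousMap.id _) := by
  refine homotopic_of_segment (isEmbedding_val_val _) _ _ fun x t ht => ?_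
  obtain ⟨⟨x, ⟨σ, hσ, i, hx⟩, hx'⟩, hlt⟩ := x
  change x _ < 1 at hlt
  refine ⟨⟨⟨_, segment_mem_partialCone (k := k + 1) hσ (hx.dropApex hlt) hx
    (fun j hj => dropApex_vanish hk hx' j (by omega)) hx' ht⟩, ?_⟩, rfl⟩
  change (1 - t) * dropApex ⟨k, hk⟩ x (Sum.inr ⟨k, hk⟩) + t * x (Sum.inr ⟨k, hk⟩) < 1
  rw [dropApex_vanish hk hx' ⟨k, hk⟩ le_rfl, mul_zero, zero_add]
  have := hx.nonneg (Sum.inr ⟨k, hk⟩)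
  nlinarith [ht.1, ht.2]

/-- Moves the coordinate at the apex `p` to the apex `o`. -/
def foldApex (o p : Fin q) (x : V ⊕ Fin q → ℝ) : V ⊕ Fin q → ℝ :=
  Sum.elim (fun v => x (Sum.inl v)) (fun j => if j = p then 0 else
    if j = o then x (Sum.inr o) + x (Sum.inr p) else x (Sum.inr j))

/-- A point of a simplex is moved only if the apex of the simplex is `p`. -/
theorem MemConeFace.foldApex {σ : Finset V} {i o p : Fin q} (hop : o ≠ p) {x : V ⊕ Fin q → ℝ}
    (hx : MemConeFace σ i x) : ∃ i, MemConeFace σ i (foldApex o p x) := by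
  have hn : ∀ w, 0 ≤ _root_.foldApex o p x w := by
    rintro (v | j)
    · exact hx.nonneg _
    · change 0 ≤ ite _ _ _
      split_ifs
      · exact le_rfl
      · exact add_nonneg (hx.nonneg _) (hx.nonneg _)
      · exact hx.nonneg _
  by_cases hi : i = p
  · subst hi
    refine ⟨o, hn, hx.left, fun j hj => ?_, ?_⟩
    · change ite _ _ _ = _
      rw [if_neg hj]
      split_ifs with h
      · rfl
      · exact hx.right j h
    · simp only [_root_.foldApex, Sum.elim_inl, Sum.elim_inr, if_neg hop, hx.right o hop, zero_add]
      exact hx.sum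
  · have h0 := hx.right p (Ne.symm hi)
    have he : _root_.foldApex o p x = x := by
      funext w
      rcases w with v | j
      · rfl
      · change ite _ _ _ = _
        split_ifs with h h'
        · rw [h, h0]
        · rw [h', h0, add_zero]
        · rfl
    exact ⟨i, he.symm ▸ hx⟩

/-- The retraction of the `(k + 1)`-cone onto the `k`-cone that folds the last cone onto the first
one. -/
def coneFold (hk0 : 0 < k) (F : PreAbstractSimplicialComplex V) :
    C(partialCone F q (k + 1), partialCone F q k) where
  toFun x := ⟨foldApex ⟨0, hk0.trans hk⟩ ⟨k, hk⟩ x.1, by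
    obtain ⟨x, ⟨σ, hσ, i, hx⟩, hx'⟩ := x
    refine ⟨⟨σ, hσ, hx.foldApex (by simpa using hk0.ne)⟩, fun j hj => ?_⟩
    change ite _ _ _ = _
    split_ifs with h h'
    · rfl
    · exact absurd (congrArg Fin.val h') (by simp; omega)
    · exact hx' j (Nat.lt_of_le_of_ne hj fun e => h (Fin.ext e.symm))⟩
  continuous_toFun := by
    refine Continuous.subtype_mk (continuous_pi fun w => ?_) _
    have hc : ∀ w, Continuous fun x : partialCone F q (k + 1) => x.1 w := fun w =>
      (continuous_apply w).comp continuous_subtype_val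
    rcases w with v | j
    · exact hc _
    · simp only [foldApex, Sum.elim_inr]
      split_ifs
      · exact continuous_const
      · exact (hc _).add (hc _)
      · exact hc _

theorem coneFold_comp_coneIncl (hk0 : 0 < k) :
    (coneFold hk hk0 F).comp (coneIncl F q k) = ContinuousMap.id (partialCone F q k) := by
  ext x : 1
  refine Subtype.ext (funext fun w => ?_)
  change foldApex _ _ x.1 w = x.1 w
  have h0 := x.2.2 ⟨k, hk⟩ le_rfl
  rcases w with v | j
  · rfl
  · change ite _ _ _ = _
    split_ifs with h h'
    · rw [h, h0]
    · rw [h', h0, add_zero]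
    · rfl

/-- The inclusion of `|F|` into the punctured open star of the last apex, halfway up the cone. -/
def baseIncl (F : PreAbstractSimplicialComplex V) :
    C(realizationSet F, (apexCompl hk F ∩ openStar hk F : Set (partialCone F q (k + 1)))) where
  toFun f := ⟨⟨Sum.elim (fun v => f.1 v / 2) (fun j => if j = ⟨k, hk⟩ then 1 / 2 else 0), by
      obtain ⟨f, h0, s, hs, hv, hsum⟩ := f
      refine ⟨⟨s, Or.inl hs, ⟨k, hk⟩, ?_, fun v hv' => ?_, fun j hj => ?_, ?_⟩, fun j hj => ?_⟩
      · rintro (v | j)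
        · exact div_nonneg (h0 v) zero_le_two
        · change 0 ≤ ite _ _ _
          split_ifs <;> norm_num
      · simp [hv v hv']
      · simp [hj]
      · simp only [Sum.elim_inl, Sum.elim_inr, ← Finset.sum_div, hsum]
        norm_num
      · have : j ≠ ⟨k, hk⟩ := by rintro rfl; simp at hj
        simp [this]⟩,
    by change ite _ _ _ < (1 : ℝ); norm_num, by change (0 : ℝ) < ite _ _ _; norm_num⟩
  continuous_toFun := by
    refine Continuous.subtype_mk (Continuous.subtype_mk (continuous_pi fun w => ?_) _) _
    rcases w with v | j
    · exact ((continuous_apply v).comp continuous_subtype_val).div_const _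
    · exact continuous_const

/-- The projection of the punctured open star of the last apex to `|F|`. -/
def baseProj (F : PreAbstractSimplicialComplex V) :
    C((apexCompl hk F ∩ openStar hk F : Set (partialCone F q (k + 1))), realizationSet F) where
  toFun x := ⟨fun v => x.1.1 (Sum.inl v) / (1 - x.1.1 (Sum.inr ⟨k, hk⟩)), by
    obtain ⟨⟨x, ⟨σ, hσ, i, hx⟩, hx'⟩, hlt, hpos⟩ := x
    change x _ < 1 at hlt
    change 0 < x _ at hpos
    obtain rfl := hx.eq_of_pos hpos
    have hs := hx.sum
    refine ⟨fun v => div_nonneg (hx.nonneg _) (sub_pos.2 hlt).le, σ, hσ.resolve_right ?_,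
      fun v hv => ?_, ?_⟩
    -- The apex itself, the only point with `σ = ∅`, is excluded.
    · rintro rfl
      rw [Finset.sum_empty, zero_add] at hs
      exact hlt.ne hs
    · change x _ / _ = 0
      rw [hx.left v hv, zero_div]
    · rw [← Finset.sum_div, div_eq_one_iff_eq (sub_pos.2 hlt).ne']
      change ∑ v ∈ σ, x (Sum.inl v) = 1 - x (Sum.inr ⟨k, hk⟩)
      linarith⟩
  continuous_toFun := by
    have hc : ∀ w, Continuous fun x :
        (apexCompl hk F ∩ openStar hk F : Set (partialCone F q (k + 1))) => x.1.1 w := fun w =>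
      (continuous_apply w).comp (isEmbedding_val_val _).continuous
    exact Continuous.subtype_mk (continuous_pi fun v =>
      (hc _).div (continuous_const.sub (hc _)) fun x => (sub_pos.2 x.2.1).ne') _

theorem baseProj_comp_baseIncl : (baseProj hk F).comp (baseIncl hk F) = ContinuousMap.id _ := by
  ext f : 1
  refine Subtype.ext (funext fun v => ?_)
  change f.1 v / 2 / (1 - ite _ _ _) = f.1 v
  rw [if_pos rfl]
  ring

theorem baseIncl_comp_baseProj :
    ((baseIncl hk F).comp (baseProj hk F)).Homotopic (ContinuousMap.id _) := by
  refine homotopic_of_segment (isEmbedding_val_val _) _ _ fun x t ht => ?_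
  -- A point and its image lie in the same simplex `σ ∪ {apex}`, and the coordinate `1 / 2` of the
  -- image at the apex keeps the segment inside the punctured star.
  have hm := (baseIncl hk F (baseProj hk F x)).1.2
  have hy : ∀ w, (baseIncl hk F (baseProj hk F x)).1.1 w = Sum.elim
    (fun v => x.1.1 (Sum.inl v) / (1 - x.1.1 (Sum.inr ⟨k, hk⟩)) / 2)
      (fun j => if j = ⟨k, hk⟩ then 1 / 2 else 0) w := fun w => rfl
  obtain ⟨⟨x, ⟨σ, hσ, i, hx⟩, hx'⟩, hlt, hpos⟩ := x
  change x _ < 1 at hlt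
  change 0 < x _ at hpos
  obtain rfl := hx.eq_of_pos hpos
  have hs := hx.sum
  have hxy : MemConeFace σ ⟨k, hk⟩
      (baseIncl hk F (baseProj hk F ⟨⟨x, ⟨σ, hσ, _, hx⟩, hx'⟩, hlt, hpos⟩)).1.1 := by
    obtain ⟨⟨σ', hσ', i', h⟩, h'⟩ := hm
    refine ⟨h.nonneg, fun v hv => ?_, fun j hj => ?_, ?_⟩
    · rw [hy]; simp [hx.left v hv]
    · rw [hy]; simp [hj]
    · simp only [hy, Sum.elim_inl, Sum.elim_inr, if_true, ← Finset.sum_div]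
      have h1 : 1 - x (Sum.inr ⟨k, hk⟩) ≠ 0 := (sub_pos.2 hlt).ne'
      have h2 : ∑ v ∈ σ, x (Sum.inl v) = 1 - x (Sum.inr ⟨k, hk⟩) := by linarith
      rw [h2, div_self h1]
      norm_num
  have hyp := hy (Sum.inr ⟨k, hk⟩)
  rw [Sum.elim_inr, if_pos rfl] at hyp
  refine ⟨⟨⟨_, segment_mem_partialCone (k := k + 1) hσ hxy hx hm.2 hx' ht⟩, ?_, ?_⟩, rfl⟩
  · change (1 - t) * _ + t * x (Sum.inr ⟨k, hk⟩) < 1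
    rw [hyp]
    nlinarith [ht.1, ht.2]
  · change 0 < (1 - t) * _ + t * x (Sum.inr ⟨k, hk⟩)
    rw [hyp]
    rcases ht.1.eq_or_lt with rfl | h
    · norm_num
    · have := mul_pos h hpos
      have := ht.2
      linarith

end Step

end Geometry

/-! ### The homology of cones with several apexes -/

noncomputable section QCone

variable {V : Type u} {F : PreAbstractSimplicialComplex V} {q k : ℕ} {R : Type v} [Ring R]
  (M : ModuleCat.{u} R)

open HomologicalComplex

/-- Up to the homotopy equivalence with the `k`-cone, the inclusion of the complement of the last
apex is that of the `k`-cone, which is split by the fold. -/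
theorem isSplitMono_homologyMap_inclC_apexCompl (hk : k < q) (hk0 : 0 < k) (n : ℕ) :
    IsSplitMono (homologyMap (concreteMap M (inclC (apexCompl hk F))) n) := by
  have hiso : IsIso (homologyMap (concreteMap M (coneInclCompl hk F)) n) :=
    isIso_homologyMap_concreteMap M _ (coneRetr hk F)
      (by rw [coneRetr_comp_coneInclCompl]) (coneInclCompl_comp_coneRetr hk) n
  have h : concreteMap M (coneInclCompl hk F) ≫ concreteMap M (inclC (apexCompl hk F)) ≫
      concreteMap M (coneFold hk hk0 F) = 𝟙 _ := by
    rw [concreteMap_comp, concreteMap_comp]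
    exact (congrArg _ (coneFold_comp_coneIncl hk hk0)).trans (concreteMap_id M)
  have h' := congrArg (homologyMap · n) h
  simp only [homologyMap_comp, homologyMap_id] at h'
  refine ⟨⟨homologyMap (concreteMap M (coneFold hk hk0 F)) n ≫
    homologyMap (concreteMap M (coneInclCompl hk F)) n, ?_⟩⟩
  rw [← cancel_epi (homologyMap (concreteMap M (coneInclCompl hk F)) n), ← Category.assoc,
    ← Category.assoc, Category.assoc _ _ (homologyMap (concreteMap M (coneFold hk hk0 F)) n), h',
    Category.id_comp, Category.comp_id]

/-- Every apex after the first contributes one copy of the homology of `|F|`. -/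
theorem nonempty_homology_partialCone_equiv {m : ℕ} (hm : m < q) (n : ℕ) :
    Nonempty ((concreteChains M (partialCone F q (m + 1))).homology (n + 1) ≃ₗ[R]
      (Fin m → (concreteChains M (realizationSet F)).homology n)) := by
  induction m with
  | zero =>
    have h := acyclic_concreteChains M _ (partialCone_one_homotopic (F := F) hm) (n + 1)
    have := ModuleCat.subsingleton_of_isZero h.isZero_homology
    exact ⟨LinearEquiv.ofSubsingleton _ _⟩
  | succ m ih =>
    obtain ⟨e₁⟩ := ih (by omega)
    obtain ⟨e₂⟩ := nonempty_homology_equiv_of_cover M (isOpen_apexCompl hm (F := F))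
      (isOpen_openStar hm) (apexCompl_union_openStar hm)
      (acyclic_concreteChains M _ (openStar_homotopic hm))
      (isSplitMono_homologyMap_inclC_apexCompl M hm m.succ_pos) n
    have h₁ : IsIso (homologyMap (concreteMap M (coneInclCompl hm F)) (n + 1)) :=
      isIso_homologyMap_concreteMap M _ (coneRetr hm F)
        (by rw [coneRetr_comp_coneInclCompl]) (coneInclCompl_comp_coneRetr hm) _
    have h₂ : IsIso (homologyMap (concreteMap M (baseIncl hm F)) n) :=
      isIso_homologyMap_concreteMap M _ (baseProj hm F)
        (by rw [baseProj_comp_baseIncl]) (baseIncl_comp_baseProj hm) _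
    let e₃ := (asIso (homologyMap (concreteMap M (coneInclCompl hm F)) (n + 1))).toLinearEquiv
    let e₄ := (asIso (homologyMap (concreteMap M (baseIncl hm F)) n)).toLinearEquiv
    exact ⟨e₂.trans (((e₃.symm.trans e₁).prodCongr e₄.symm).trans
      ((LinearEquiv.prodComm R _ _).trans (Fin.consLinearEquiv R
        fun _ => (concreteChains M (realizationSet F)).homology n)))⟩

theorem partialCone_self (hq : 0 < q) : partialCone F q q = realizationSet (qCone F q) := by
  ext x
  rw [mem_realizationSet_qCone_iff ⟨0, hq⟩]
  exact ⟨fun h => h.1, fun h => ⟨h, fun j hj => absurd j.2 (by omega)⟩⟩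

end QCone

theorem mainTheorem10 {V : Type u} (F : PreAbstractSimplicialComplex V) (hF : F.faces.Finite)
    (q : ℕ) (hq : 1 ≤ q) {R : Type v} [Ring R] (M : ModuleCat.{u} R) (n : ℤ) :
    Nonempty (reducedHomology M (geometricRealization (qCone F q)) n ≃ₗ[R]
      DirectSum (Fin (q - 1))
        (fun _ => reducedHomology M (geometricRealization F) (n - 1))) := by
  rcases n with n | _ | n
  · obtain ⟨e⟩ := nonempty_homology_partialCone_equiv (F := F) M (Nat.sub_lt hq one_pos) n
    rw [Nat.sub_add_cancel hq, partialCone_self hq] at e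
    exact ⟨(reducedHomologyEquiv M (geometricRealization (qCone F q)) n).trans
      (e.trans ((LinearEquiv.piCongrRight fun _ =>
        (reducedHomologySubOneEquiv M (geometricRealization F) n).symm).trans
          (DirectSum.linearEquivFunOnFintype R (Fin (q - 1)) _).symm))⟩
  -- In degree `-1` both sides vanish, since the `q`-cone is nonempty.
  · have hx : apex V ⟨0, hq⟩ ∈ realizationSet (qCone F q) :=
      partialCone_self (F := F) hq ▸ apex_mem_partialCone F hq
    have h₁ := ModuleCat.subsingleton_of_isZero
      (isZero_homology_zero M (X := geometricRealization (qCone F q)) ⟨_, hx⟩)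
    have h₂ : Subsingleton (reducedHomology M (geometricRealization (qCone F q))
        (Int.negSucc 0)) :=
      (reducedHomologySubOneEquiv M (geometricRealization (qCone F q)) 0).toEquiv.subsingleton
    have h₃ : Subsingleton (DirectSum (Fin (q - 1)) fun _ : Fin (q - 1) =>
        reducedHomology M (geometricRealization F) (Int.negSucc 0 - 1)) :=
      ⟨fun a b => DFinsupp.ext fun i => Subsingleton.elim (α := PUnit) _ _⟩
    exact ⟨LinearEquiv.ofSubsingleton _ _⟩
  -- In degrees below `-1` both sides vanish by definition.
  · have h₂ : Subsingleton (reducedHomology M (geometricRealization (qCone F q))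
        (Int.negSucc (n + 1))) := inferInstanceAs (Subsingleton PUnit)
    have h₃ : Subsingleton (DirectSum (Fin (q - 1)) fun _ : Fin (q - 1) =>
        reducedHomology M (geometricRealization F) (Int.negSucc (n + 1) - 1)) :=
      ⟨fun a b => DFinsupp.ext fun i => Subsingleton.elim (α := PUnit) _ _⟩
    exact ⟨LinearEquiv.ofSubsingleton _ _⟩
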